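/- Let $(M,g)$ be a smooth Riemannian manifold with Levi-Civita connection $\nabla$, let $R(X,Y)=[\nabla_X,\nabla_Y]-\nabla_{[X,Y]}$ be its curvature, and let $f\in C^\infty(M)$, $f>0$. Let $\pi:T^*M\to M$ be the cotangent bundle with the induced coordinates $(x^i,p_i)$. Write $g^{-1}(\omega,\theta)=g^{ij}\omega_i\theta_j$ for covectors, and put $\alpha=1+g^{-1}(p,p)$, a function on $T^*M$. For a vector field $X$ and a one-form $\omega$ on $M$ the horizontal and the vertical lift to $T^*M$ are $${}^HX=X^i\frac{\partial}{\partial x^i}+p_h\Gamma^h_{ij}X^j\frac{\partial}{\partial p_i},\qquad {}^V\omega=\omega_i\frac{\partial}{\partial p_i},$$ and the same formulas define, at a given point $p\in T^*M$, the lifts of a tangent vector or a covector at $\pi(p)$. Let ${}^{CG}g_f$ be the Riemannian metric on $T^*M$ determined by $${}^{CG}g_f({}^V\omega,{}^V\theta)=\frac1\alpha\bigl(g^{-1}(\omega,\theta)+g^{-1}(\omega,p)\,g^{-1}(\theta,p)\bigr),\qquad {}^{CG}g_f({}^V\omega,{}^HY)=0,\qquad {}^{CG}g_f({}^HX,{}^HY)=f\,g(X,Y),$$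 and let $\widetilde\nabla$ be its Levi-Civita connection. Let ${}^fA$ be the $(1,2)$-tensor field $${}^fA(X,Y)=\frac1{2f}\bigl(X(f)\,Y+Y(f)\,X-g(X,Y)\,\mathrm{grad}_g f\bigr),$$ and let $\gamma\delta=p_i\,\partial/\partial p_i$ be the Liouville vector field on $T^*M$. For a one-form $\omega$ let $\tilde\omega=g^{-1}\circ\omega$ be the $g$-dual vector field. At a point $p\in T^*M$ let $p\circ R(X,Y)$ be the covector $Z\mapsto p(R(X,Y)Z)$, and let $p(g^{-1}\circ R(\ ,X)\tilde\omega)$ be the tangent vector that is $g$-dual to the covector $Z\mapsto p(R(Z,X)\tilde\omega)$. Then for all smooth vector fields $X,Y$ and smooth one-forms $\omega,\theta$ on $M$, at every point $p$ of $T^*M$: (i) $\widetilde\nabla_{{}^HX}{}^HY={}^H\bigl(\nabla_XY+{}^fA(X,Y)\bigr)+\frac12\,{}^V\bigl(p\circ R(X,Y)\bigr)$; (ii) $\widetilde\nabla_{{}^HX}{}^V\theta=\frac1{2f\alpha}\,{}^H\bigl(p(g^{-1}\circ R(\ ,X)\tilde\theta)\bigr)+{}^V(\nabla_X\theta)$;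 (iii) $\widetilde\nabla_{{}^V\omega}{}^HY=\frac1{2f\alpha}\,{}^H\bigl(p(g^{-1}\circ R(\ ,Y)\tilde\omega)\bigr)$; (iv) $\widetilde\nabla_{{}^V\omega}{}^V\theta=-\frac1\alpha\bigl({}^{CG}g_f({}^V\omega,\gamma\delta)\,{}^V\theta+{}^{CG}g_f({}^V\theta,\gamma\delta)\,{}^V\omega\bigr)+\frac{\alpha+1}{\alpha}\,{}^{CG}g_f({}^V\omega,{}^V\theta)\,\gamma\delta-\frac1\alpha\,{}^{CG}g_f({}^V\omega,\gamma\delta)\,{}^{CG}g_f({}^V\theta,\gamma\delta)\,\gamma\delta$. -/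

import Mathlib

open Bundle
open scoped Manifold ContDiff

set_option linter.unusedSectionVars false

noncomputable section

namespace CotangentGeometry

/-! ### Levi-Civita connections -/

section LeviCivita

variable {E : Type*} [NormedAddCommGroup E] [NormedSpace ℝ E]
  {H : Type*} [TopologicalSpace H] {I : ModelWithCorners ℝ E H}
  {M : Type*} [TopologicalSpace M] [ChartedSpace H M] [IsManifold I 1 M]

/-- `∇` is a Levi-Civita connection of the metric `G`: it is torsion free and metric.
Here `cov Y x v` is `(∇_v Y)(x)`. -/
structure IsLeviCivita (G : ∀ x : M, TangentSpace I x → TangentSpace I x → ℝ)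
    (cov : CovariantDerivative I E (TangentSpace I : M → Type _)) : Prop where
  torsion_free : ∀ (x : M) (X Y : Π y : M, TangentSpace I y),
    MDifferentiableAt I I.tangent (fun y ↦ (⟨y, X y⟩ : TangentBundle I M)) x →
    MDifferentiableAt I I.tangent (fun y ↦ (⟨y, Y y⟩ : TangentBundle I M)) x →
    cov Y x (X x) - cov X x (Y x) = VectorField.mlieBracket I X Y x
  metric : ∀ (x : M) (v : TangentSpace I x) (Y Z : Π y : M, TangentSpace I y),
    MDifferentiableAt I I.tangent (fun y ↦ (⟨y, Y y⟩ : TangentBundle I M)) x →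
    MDifferentiableAt I I.tangent (fun y ↦ (⟨y, Z y⟩ : TangentBundle I M)) x →
    mvfderiv I (fun y ↦ G y (Y y) (Z y)) x v = G x (cov Y x v) (Z x) + G x (Y x) (cov Z x v)

end LeviCivita

variable {E : Type*} [NormedAddCommGroup E] [NormedSpace ℝ E]
  {M : Type*} [TopologicalSpace M] [ChartedSpace E M]

/-- The cotangent space `T*_x M`. -/
abbrev Cotangent (E : Type*) [NormedAddCommGroup E] [NormedSpace ℝ E]
    {M : Type*} [TopologicalSpace M] [ChartedSpace E M] (x : M) : Type _ :=
  TangentSpace 𝓘(ℝ, E) x →L[ℝ] ℝ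

variable [IsManifold 𝓘(ℝ, E) ∞ M]

/-- The total space `T*M` of the cotangent bundle, with its standard manifold structure; a point
`p` is a pair of the base point `p.proj` and the covector `p.2` at `p.proj`. -/
abbrev CotangentBundle (E : Type*) [NormedAddCommGroup E] [NormedSpace ℝ E]
    (M : Type*) [TopologicalSpace M] [ChartedSpace E M] : Type _ :=
  TotalSpace (E →L[ℝ] ℝ) (Cotangent E : M → Type _)

/-- The model with corners of `T*M`. -/
abbrev cotModel (E : Type*) [NormedAddCommGroup E] [NormedSpace ℝ E] :
    ModelWithCorners ℝ (E × (E →L[ℝ] ℝ)) (ModelProd E (E →L[ℝ] ℝ)) :=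
  𝓘(ℝ, E).prod 𝓘(ℝ, E →L[ℝ] ℝ)

/-- Smooth vector fields on `M`. -/
abbrev SmoothVectorField (E : Type*) [NormedAddCommGroup E] [NormedSpace ℝ E]
    (M : Type*) [TopologicalSpace M] [ChartedSpace E M] [IsManifold 𝓘(ℝ, E) ∞ M] : Type _ :=
  ContMDiffSection 𝓘(ℝ, E) E ∞ (TangentSpace 𝓘(ℝ, E) : M → Type _)

/-- Smooth one-forms on `M`. -/
abbrev SmoothOneForm (E : Type*) [NormedAddCommGroup E] [NormedSpace ℝ E]
    (M : Type*) [TopologicalSpace M] [ChartedSpace E M] [IsManifold 𝓘(ℝ, E) ∞ M] : Type _ :=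
  ContMDiffSection 𝓘(ℝ, E) (E →L[ℝ] ℝ) ∞ (Cotangent E : M → Type _)

/-- Linear connections on `M`. -/
abbrev Connection (E : Type*) [NormedAddCommGroup E] [NormedSpace ℝ E]
    (M : Type*) [TopologicalSpace M] [ChartedSpace E M] [IsManifold 𝓘(ℝ, E) ∞ M] : Type _ :=
  CovariantDerivative 𝓘(ℝ, E) E (TangentSpace 𝓘(ℝ, E) : M → Type _)

/-- Linear connections on `T*M`. -/
abbrev CotConnection (E : Type*) [NormedAddCommGroup E] [NormedSpace ℝ E]
    (M : Type*) [TopologicalSpace M] [ChartedSpace E M] [IsManifold 𝓘(ℝ, E) ∞ M] : Type _ :=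
  CovariantDerivative (cotModel E) (E × (E →L[ℝ] ℝ))
    (TangentSpace (cotModel E) : CotangentBundle E M → Type _)

/-- Smooth Riemannian metrics on `M`. -/
abbrev Metric (E : Type*) [NormedAddCommGroup E] [NormedSpace ℝ E]
    (M : Type*) [TopologicalSpace M] [ChartedSpace E M] [IsManifold 𝓘(ℝ, E) ∞ M] : Type _ :=
  ContMDiffRiemannianMetric 𝓘(ℝ, E) ∞ E (TangentSpace 𝓘(ℝ, E) : M → Type _)

/-! ### Coordinate fields, Christoffel symbols, curvature, covariant derivative of one-forms -/

/-- The vector field `w^i ∂_i` with constant components in the preferred chart at `x`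
(zero outside of the domain of that chart). Its value at `x` is `w`. -/
def coordField (x : M) (w : TangentSpace 𝓘(ℝ, E) x) (y : M) : TangentSpace 𝓘(ℝ, E) y :=
  (trivializationAt E (TangentSpace 𝓘(ℝ, E) : M → Type _) x).symmL ℝ y w

lemma coordField_eq_extend (x : M) (w : TangentSpace 𝓘(ℝ, E) x) {y : M}
    (hy : y ∈ (trivializationAt E (TangentSpace 𝓘(ℝ, E) : M → Type _) x).baseSet) :
    coordField x w y = FiberBundle.extend E w y := by
  have h : (trivializationAt E (TangentSpace 𝓘(ℝ, E) : M → Type _) x ⟨x, w⟩).2 = w :=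
    (tangentBundleCore 𝓘(ℝ, E) M).coordChange_self (achart E x) x (mem_chart_source E x) w
  unfold coordField FiberBundle.extend
  rw [h]
  exact Trivialization.symmL_apply _ hy w

lemma coordField_self (x : M) (w : TangentSpace 𝓘(ℝ, E) x) : coordField x w x = w := by
  rw [coordField_eq_extend x w (FiberBundle.mem_baseSet_trivializationAt' x),
    FiberBundle.extend_apply_self]

lemma mdifferentiableAt_coordField (x : M) (w : TangentSpace 𝓘(ℝ, E) x) :
    MDifferentiableAt 𝓘(ℝ, E) 𝓘(ℝ, E).tangent
      (fun y ↦ (⟨y, coordField x w y⟩ : TangentBundle 𝓘(ℝ, E) M)) x := by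
  refine (FiberBundle.mdifferentiableAt_extend 𝓘(ℝ, E) E w).congr_of_eventuallyEq ?_
  filter_upwards [(trivializationAt E (TangentSpace 𝓘(ℝ, E) : M → Type _) x).open_baseSet.mem_nhds
    (FiberBundle.mem_baseSet_trivializationAt' x)] with y hy
  rw [coordField_eq_extend x w hy]

lemma coordField_add (x : M) (w w' : TangentSpace 𝓘(ℝ, E) x) :
    coordField x (w + w') = coordField x w + coordField x w' :=
  funext fun y ↦ ((trivializationAt E (TangentSpace 𝓘(ℝ, E) : M → Type _) x).symmL ℝ y).map_add w w'

lemma coordField_smul (x : M) (c : ℝ) (w : TangentSpace 𝓘(ℝ, E) x) :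
    coordField x (c • w) = c • coordField x w :=
  funext fun y ↦ ((trivializationAt E (TangentSpace 𝓘(ℝ, E) : M → Type _) x).symmL ℝ y).map_smul c w

variable [FiniteDimensional ℝ E]

/-- The Christoffel symbols at `x` in the preferred chart at `x`:
`christoffel cov x v w = Γ^h_{ij} v^i w^j ∂_h`, that is `∇_v (w^j ∂_j)`. -/
def christoffel (cov : Connection E M) (x : M) (v : TangentSpace 𝓘(ℝ, E) x) :
    TangentSpace 𝓘(ℝ, E) x →L[ℝ] TangentSpace 𝓘(ℝ, E) x :=
  haveI : FiniteDimensional ℝ (TangentSpace 𝓘(ℝ, E) x) := inferInstanceAs (FiniteDimensional ℝ E)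
  haveI : T2Space (TangentSpace 𝓘(ℝ, E) x) := inferInstanceAs (T2Space E)
  LinearMap.toContinuousLinearMap
    { toFun := fun w ↦ cov (coordField x w) x v
      map_add' := fun w w' ↦ by
        rw [coordField_add, cov.isCovariantDerivativeOnUniv.add
          (mdifferentiableAt_coordField x w) (mdifferentiableAt_coordField x w')]
        rfl
      map_smul' := fun c w ↦ by
        rw [coordField_smul, cov.isCovariantDerivativeOnUniv.smul_const c
          (mdifferentiableAt_coordField x w)]
        rfl }

/-- The vector field `R(X, Y) Z = ∇_X ∇_Y Z - ∇_Y ∇_X Z - ∇_{[X, Y]} Z`. -/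
def riemann (cov : Connection E M) (X Y Z : Π y : M, TangentSpace 𝓘(ℝ, E) y) (x : M) :
    TangentSpace 𝓘(ℝ, E) x :=
  cov (fun y ↦ cov Z y (Y y)) x (X x) - cov (fun y ↦ cov Z y (X y)) x (Y x)
    - cov Z x (VectorField.mlieBracket 𝓘(ℝ, E) X Y x)

/-- The curvature tensor at `x`: the trilinear map `(u, v, w) ↦ R(u, v) w` whose value on the
coordinate frame `∂_i` of the preferred chart at `x` is `R(∂_i, ∂_j) ∂_l`. -/
def curvature (cov : Connection E M) (x : M) :
    TangentSpace 𝓘(ℝ, E) x →ₗ[ℝ] TangentSpace 𝓘(ℝ, E) x →ₗ[ℝ]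
      TangentSpace 𝓘(ℝ, E) x →ₗ[ℝ] TangentSpace 𝓘(ℝ, E) x :=
  haveI b : Module.Basis (Fin (Module.finrank ℝ E)) ℝ (TangentSpace 𝓘(ℝ, E) x) :=
    Module.finBasis ℝ E
  b.constr ℝ fun i ↦ b.constr ℝ fun j ↦ b.constr ℝ fun l ↦
    riemann cov (coordField x (b i)) (coordField x (b j)) (coordField x (b l)) x

/-- A linear form on `T_x M`, seen as an element of `T*_x M`. -/
def toCotangent {x : M} (φ : TangentSpace 𝓘(ℝ, E) x →ₗ[ℝ] ℝ) : Cotangent E x :=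
  haveI : FiniteDimensional ℝ (TangentSpace 𝓘(ℝ, E) x) := inferInstanceAs (FiniteDimensional ℝ E)
  haveI : T2Space (TangentSpace 𝓘(ℝ, E) x) := inferInstanceAs (T2Space E)
  LinearMap.toContinuousLinearMap φ

lemma tensorialAt_covOneForm (cov : Connection E M) (θ : SmoothOneForm E M) (x : M)
    (v : TangentSpace 𝓘(ℝ, E) x) :
    TensorialAt 𝓘(ℝ, E) E (fun W : (Π y : M, TangentSpace 𝓘(ℝ, E) y) ↦
      mvfderiv 𝓘(ℝ, E) (fun y ↦ θ y (W y)) x v - θ x (cov W x v)) x := by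
  have key : ∀ {W : Π y : M, TangentSpace 𝓘(ℝ, E) y},
      MDifferentiableAt 𝓘(ℝ, E) 𝓘(ℝ, E).tangent
        (fun y ↦ (⟨y, W y⟩ : TangentBundle 𝓘(ℝ, E) M)) x →
      MDifferentiableAt 𝓘(ℝ, E) 𝓘(ℝ, ℝ) (fun y ↦ θ y (W y)) x := by
    intro W hW
    have hθ := (θ.contMDiff x).mdifferentiableAt (by simp)
    have h := MDifferentiableAt.clm_bundle_apply (F₂ := ℝ) (E₂ := Bundle.Trivial M ℝ)
      (b := fun y : M ↦ y) (ϕ := fun y ↦ θ y) hθ hW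
    exact ((mdifferentiableAt_totalSpace ..).1 h).2
  constructor
  · intro f W hf hW
    have h1 := cov.isCovariantDerivativeOnUniv.leibniz hW hf
    have h2 : (fun y ↦ θ y ((f • W) y)) = fun y ↦ f y * θ y (W y) := by
      funext y; simp
    rw [h1, h2, mvfderiv_fun_mul hf (key hW)]
    simp
    ring
  · intro W W' hW hW'
    have h1 := cov.isCovariantDerivativeOnUniv.add hW hW'
    have h2 : (fun y ↦ θ y ((W + W') y)) = fun y ↦ θ y (W y) + θ y (W' y) := by
      funext y; simp
    rw [h1, h2, mvfderiv_fun_add (key hW) (key hW')]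
    simp
    ring

/-- The covariant derivative `∇_v θ` of a one-form: `(∇_v θ)(W) = v(θ(W)) - θ(∇_v W)`. -/
def covOneForm (cov : Connection E M) (θ : SmoothOneForm E M) (x : M)
    (v : TangentSpace 𝓘(ℝ, E) x) : Cotangent E x :=
  TensorialAt.mkHom _ x (tensorialAt_covOneForm cov θ x v)

/-! ### Musical isomorphisms and the tensor `A` -/

lemma inner_injective (g : Metric E M) (x : M) :
    Function.Injective (g.inner x : TangentSpace 𝓘(ℝ, E) x →ₗ[ℝ] Cotangent E x) := by
  refine (injective_iff_map_eq_zero _).2 fun v hv ↦ ?_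
  by_contra h
  have h1 := g.pos x v h
  have h2 : g.inner x v = 0 := hv
  simp [h2] at h1

/-- The isomorphism `T_x M ≃ T*_x M`, `v ↦ g(v, ·)`. -/
def flat (g : Metric E M) (x : M) : TangentSpace 𝓘(ℝ, E) x ≃ₗ[ℝ] Cotangent E x :=
  haveI : FiniteDimensional ℝ (TangentSpace 𝓘(ℝ, E) x) := inferInstanceAs (FiniteDimensional ℝ E)
  haveI : FiniteDimensional ℝ (Cotangent E x) := inferInstanceAs (FiniteDimensional ℝ (E →L[ℝ] ℝ))
  LinearEquiv.ofInjectiveOfFinrankEq _ (inner_injective g x)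
    ((LinearMap.toContinuousLinearMap (𝕜 := ℝ) (E := E) (F' := ℝ)).finrank_eq.symm.trans
      Subspace.dual_finrank_eq).symm

lemma flat_apply (g : Metric E M) (x : M) (v : TangentSpace 𝓘(ℝ, E) x) :
    flat g x v = g.inner x v := rfl

/-- The vector `g⁻¹ ∘ θ` with components `g^{ij} θ_j`. -/
def sharp (g : Metric E M) {x : M} (θ : Cotangent E x) : TangentSpace 𝓘(ℝ, E) x :=
  (flat g x).symm θ

/-- The inner product `g⁻¹(η, θ) = g^{ij} η_i θ_j` of covectors. -/
def coinner (g : Metric E M) {x : M} (η θ : Cotangent E x) : ℝ := η (sharp g θ)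

/-- The tensor `A(u, v) = (1 / 2f) (df(u) v + df(v) u - g(u, v) grad f)`. -/
def tensorA (g : Metric E M) (f : M → ℝ) (x : M) (u v : TangentSpace 𝓘(ℝ, E) x) :
    TangentSpace 𝓘(ℝ, E) x :=
  (1 / (2 * f x)) • (mvfderiv 𝓘(ℝ, E) f x u • v + mvfderiv 𝓘(ℝ, E) f x v • u
    - g.inner x u v • sharp g (mvfderiv 𝓘(ℝ, E) f x))

/-! ### Lifts to the cotangent bundle and the metric

The tangent space of `T*M` at `p` is `E × E*`: a pair `(v, ζ)` stands for the tangent vector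
`v^i ∂/∂x^i + ζ_i ∂/∂p_i` in the coordinates `(x^i, p_i)` induced by the preferred chart of `M`
at `p.proj`. -/

/-- The vertical lift `θ_i ∂/∂p_i` of a covector, at `p`. -/
def vLift (p : CotangentBundle E M) (θ : Cotangent E p.proj) : TangentSpace (cotModel E) p :=
  ((0 : E), (θ : E →L[ℝ] ℝ))

/-- The horizontal lift `v^i ∂/∂x^i + p_h Γ^h_{ij} v^j ∂/∂p_i` of a tangent vector, at `p`. -/
def hLift (cov : Connection E M) (p : CotangentBundle E M) (v : TangentSpace 𝓘(ℝ, E) p.proj) :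
    TangentSpace (cotModel E) p :=
  ((v : E), (p.2.comp (christoffel cov p.proj v) : E →L[ℝ] ℝ))

/-- The vector `u` in the decomposition `ξ = hLift u + vLift θ`. -/
def hPart (p : CotangentBundle E M) (ξ : TangentSpace (cotModel E) p) :
    TangentSpace 𝓘(ℝ, E) p.proj :=
  (show E × (E →L[ℝ] ℝ) from ξ).1

/-- The covector `θ` in the decomposition `ξ = hLift u + vLift θ`. -/
def vPart (cov : Connection E M) (p : CotangentBundle E M) (ξ : TangentSpace (cotModel E) p) :
    Cotangent E p.proj :=
  (show Cotangent E p.proj from (show E × (E →L[ℝ] ℝ) from ξ).2)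
    - p.2.comp (christoffel cov p.proj (hPart p ξ))

/-- The function `α = 1 + r²`, `r² = g⁻¹(p, p)`, on `T*M`. -/
def alpha (g : Metric E M) (p : CotangentBundle E M) : ℝ := 1 + coinner g p.2 p.2

/-- The rescaled metric of Cheeger-Gromoll type on `T*M`; it is the bilinear form determined by
its values on lifts, see `cgMetric_vLift_vLift`, `cgMetric_vLift_hLift`, `cgMetric_hLift_hLift`. -/
def cgMetric (g : Metric E M) (cov : Connection E M) (f : M → ℝ) (p : CotangentBundle E M)
    (ξ ζ : TangentSpace (cotModel E) p) : ℝ :=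
  f p.proj * g.inner p.proj (hPart p ξ) (hPart p ζ)
    + 1 / alpha g p * (coinner g (vPart cov p ξ) (vPart cov p ζ)
      + coinner g (vPart cov p ξ) p.2 * coinner g (vPart cov p ζ) p.2)

/-- The canonical (Liouville) vector field `p_i ∂/∂p_i` on `T*M`. -/
def liouville (p : CotangentBundle E M) : TangentSpace (cotModel E) p := vLift p p.2

lemma hLift_add_vLift (cov : Connection E M) (p : CotangentBundle E M)
    (ξ : TangentSpace (cotModel E) p) :
    hLift cov p (hPart p ξ) + vLift p (vPart cov p ξ) = ξ := by
  refine Prod.ext ?_ ?_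
  · exact add_zero (show E × (E →L[ℝ] ℝ) from ξ).1
  · exact add_sub_cancel (p.2.comp (christoffel cov p.proj (hPart p ξ)))
      (show Cotangent E p.proj from (show E × (E →L[ℝ] ℝ) from ξ).2)

@[simp] lemma hPart_hLift (cov : Connection E M) (p : CotangentBundle E M)
    (v : TangentSpace 𝓘(ℝ, E) p.proj) : hPart p (hLift cov p v) = v := rfl

@[simp] lemma hPart_vLift (p : CotangentBundle E M) (θ : Cotangent E p.proj) :
    hPart p (vLift p θ) = 0 := rfl

@[simp] lemma vPart_hLift (cov : Connection E M) (p : CotangentBundle E M)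
    (v : TangentSpace 𝓘(ℝ, E) p.proj) : vPart cov p (hLift cov p v) = 0 :=
  sub_self (p.2.comp (christoffel cov p.proj v))

lemma christoffel_zero (cov : Connection E M) (x : M) : christoffel cov x 0 = 0 := by
  ext w
  exact map_zero (cov (coordField x w) x)

@[simp] lemma vPart_vLift (cov : Connection E M) (p : CotangentBundle E M)
    (θ : Cotangent E p.proj) : vPart cov p (vLift p θ) = θ := by
  have h : vPart cov p (vLift p θ) = θ - p.2.comp (christoffel cov p.proj 0) := rfl
  rw [h, christoffel_zero, ContinuousLinearMap.comp_zero, sub_zero]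

lemma coinner_zero_left (g : Metric E M) {x : M} (θ : Cotangent E x) : coinner g 0 θ = 0 := rfl

lemma coinner_zero_right (g : Metric E M) {x : M} (θ : Cotangent E x) : coinner g θ 0 = 0 := by
  simp [coinner, sharp]

lemma cgMetric_vLift_vLift (g : Metric E M) (cov : Connection E M) (f : M → ℝ)
    (p : CotangentBundle E M) (η θ : Cotangent E p.proj) :
    cgMetric g cov f p (vLift p η) (vLift p θ)
      = 1 / alpha g p * (coinner g η θ + coinner g η p.2 * coinner g θ p.2) := by
  simp [cgMetric]

lemma cgMetric_vLift_hLift (g : Metric E M) (cov : Connection E M) (f : M → ℝ)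
    (p : CotangentBundle E M) (η : Cotangent E p.proj) (v : TangentSpace 𝓘(ℝ, E) p.proj) :
    cgMetric g cov f p (vLift p η) (hLift cov p v) = 0 := by
  simp [cgMetric, coinner_zero_left, coinner_zero_right]

lemma cgMetric_hLift_hLift (g : Metric E M) (cov : Connection E M) (f : M → ℝ)
    (p : CotangentBundle E M) (u v : TangentSpace 𝓘(ℝ, E) p.proj) :
    cgMetric g cov f p (hLift cov p u) (hLift cov p v) = f p.proj * g.inner p.proj u v := by
  simp [cgMetric, coinner_zero_left]

/-- The covector `p ∘ R(u, v) : w ↦ p(R(u, v) w)` at `p`. -/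
def pCurvature (cov : Connection E M) (p : CotangentBundle E M)
    (u v : TangentSpace 𝓘(ℝ, E) p.proj) : Cotangent E p.proj :=
  toCotangent ((p.2 : TangentSpace 𝓘(ℝ, E) p.proj →ₗ[ℝ] ℝ) ∘ₗ curvature cov p.proj u v)

/-- The vector `p (g⁻¹ ∘ R( , v) w)` at `p`, with components `p_s g^{kt} R_{tjm}^s v^j w^m`:
the vector that is dual with respect to `g` to the covector `u ↦ p(R(u, v) w)`. -/
def pSharpCurvature (g : Metric E M) (cov : Connection E M) (p : CotangentBundle E M)
    (v w : TangentSpace 𝓘(ℝ, E) p.proj) : TangentSpace 𝓘(ℝ, E) p.proj :=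
  sharp g (toCotangent
    ((p.2 : TangentSpace 𝓘(ℝ, E) p.proj →ₗ[ℝ] ℝ) ∘ₗ ((curvature cov p.proj).flip v).flip w))

end CotangentGeometry

end

open CotangentGeometry

noncomputable section

namespace CotangentGeometry

open Filter VectorField
open scoped Topology

section

/-! ### Derivatives of functions on a boundaryless manifold -/

section Manifold

variable {E : Type*} [NormedAddCommGroup E] [NormedSpace ℝ E]
  {H : Type*} [TopologicalSpace H] {I : ModelWithCorners ℝ E H} [I.Boundaryless]
  {M : Type*} [TopologicalSpace M] [ChartedSpace H M]
  {F : Type*} [NormedAddCommGroup F] [NormedSpace ℝ F]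

/-! Horizontal and vertical lifts span every tangent space of `T*M` and the metric is positive
definite, so the Koszul formula determines the connection once two things are known: the derivatives
of the metric along lifts, and the brackets of lifts. A one-form is always written as the `g`-dual
of a vector field `A`, so that all data are fields on `M`, lifted as `hField` and `vField`.

Both ingredients follow from one computation, `mvfderiv_liftEval`: a tangent vector `ξ` with
horizontal part `u` and vertical part `ζ` sends the function `p ↦ p(Z)` to `p(∇_u Z) + ζ(Z)`. These
functions, together with those pulled back from `M`, separate tangent vectors. Evaluating
commutators on them gives `[HX, HY] = H[X, Y] + V(p ∘ R(X, Y))`, `[HX, VA] = V(∇_X A)` and `[VA, VB]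
= 0` (`vPart_mlieBracket_hField`, `mlieBracket_hField_vField`, `mlieBracket_vField_vField`). The
derivative of `α` is zero along `HX` and `2p(A)` along `VA` (`mvfderiv_alpha`).

In the Koszul formula the derivative of `f` then produces the tensor `A`, the curvature enters only
through `[HX, HY]`, and the purely vertical formula comes from differentiating `1/α` and `p(A)p(B)`
along the fibre. Constancy of `α` along horizontal lifts also gives `p(R(X, Y)p♯) = 0`, which
removes the rank-one term of the vertical metric from the mixed formulas. Formula (ii) is (iii) plus
the bracket `[HX, VA]`. -/

lemma hasMFDerivAt_of_eventuallyEq_comp_extChartAt [IsManifold I 1 M] {x : M} {φ : M → F}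
    {φ' : E → F} {D : E →L[ℝ] F} (h : φ =ᶠ[𝓝 x] φ' ∘ extChartAt I x)
    (hD : HasFDerivAt φ' D (extChartAt I x x)) :
    HasMFDerivAt I 𝓘(ℝ, F) φ x D := by
  refine HasMFDerivAt.congr_of_eventuallyEq ?_ h
  have h1 : HasMFDerivAt I 𝓘(ℝ, E) (extChartAt I x) x (ContinuousLinearMap.id ℝ E) := by
    have h2 := (mdifferentiableAt_extChartAt (I := I) (mem_chart_source H x)).hasMFDerivAt
    rw [mfderiv_extChartAt_self] at h2
    exact h2
  exact (hD.hasMFDerivAt).comp x h1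

lemma mvfderiv_of_eventuallyEq_comp_extChartAt [IsManifold I 1 M] {x : M} {φ : M → F}
    {φ' : E → F} {D : E →L[ℝ] F} (h : φ =ᶠ[𝓝 x] φ' ∘ extChartAt I x)
    (hD : HasFDerivAt φ' D (extChartAt I x x)) (v : TangentSpace I x) :
    mvfderiv I φ x v = D v := by
  have h1 := (hasMFDerivAt_of_eventuallyEq_comp_extChartAt h hD).mfderiv
  unfold mvfderiv
  rw [h1]
  rfl

lemma mvfderiv_congr {x : M} {φ ψ : M → F} (h : φ =ᶠ[𝓝 x] ψ) (v : TangentSpace I x) :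
    mvfderiv I φ x v = mvfderiv I ψ x v := by
  have h1 := h.mfderiv_eq (I := I) (I' := 𝓘(ℝ, F))
  change (mfderiv I 𝓘(ℝ, F) φ x v : F) = (mfderiv I 𝓘(ℝ, F) ψ x v : F)
  exact congrArg (fun L : E →L[ℝ] F ↦ L v) h1

variable (I) in
/-- The components of a vector field in the preferred chart at `x`. -/
def chartField [IsManifold I 1 M] (x : M) (V : Π y : M, TangentSpace I y) (z : E) : E :=
  mpullbackWithin 𝓘(ℝ, E) I (extChartAt I x).symm V (Set.range I) z

/-- The differential of the inverse chart is invertible and carries the chart components of `V` to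
`V`, so the chain rule moves the derivative to the model space. As there is no boundary, derivatives
within `range I` are ordinary ones. -/
lemma mvfderiv_extChartAt_symm [IsManifold I 1 M] {x : M} {φ : M → F}
    (V : Π y : M, TangentSpace I y) {z : E} (hz : z ∈ (extChartAt I x).target)
    (hφ : MDifferentiableAt I 𝓘(ℝ, F) φ ((extChartAt I x).symm z)) :
    mvfderiv I φ ((extChartAt I x).symm z) (V ((extChartAt I x).symm z))
      = fderiv ℝ (φ ∘ (extChartAt I x).symm) z (chartField I x V z) := by
  have h1 : MDifferentiableWithinAt 𝓘(ℝ, E) I (extChartAt I x).symm (Set.range I) z :=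
    mdifferentiableWithinAt_extChartAt_symm hz
  have h2 : HasMFDerivAt 𝓘(ℝ, E) I (extChartAt I x).symm z
      (mfderivWithin 𝓘(ℝ, E) I (extChartAt I x).symm (Set.range I) z) := by
    have := h1.hasMFDerivWithinAt
    rw [I.range_eq_univ, hasMFDerivWithinAt_univ] at this
    rw [I.range_eq_univ]
    exact this
  obtain ⟨D, hD⟩ : ∃ D : E →L[ℝ] F, D = (mfderiv I 𝓘(ℝ, F) φ ((extChartAt I x).symm z)).comp
      (mfderivWithin 𝓘(ℝ, E) I (extChartAt I x).symm (Set.range I) z) := ⟨_, rfl⟩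
  have h3 : HasFDerivAt (φ ∘ (extChartAt I x).symm) D z :=
    hasMFDerivAt_iff_hasFDerivAt.1 (hD ▸ hφ.hasMFDerivAt.comp z h2)
  have h4 := isInvertible_mfderivWithin_extChartAt_symm (I := I) hz
  have h5 := ContinuousLinearMap.IsInvertible.self_apply_inverse h4 (V ((extChartAt I x).symm z))
  have h6 := congrArg (fun L : E →L[ℝ] F ↦ L (chartField I x V z)) hD
  rw [h3.fderiv]
  exact (h6.trans (congrArg (mfderiv I 𝓘(ℝ, F) φ ((extChartAt I x).symm z)) h5)).symm

/-- The differential at `x` of the preferred chart at `x` is the identity, so differentiating the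
chart itself along `V` reads off the components. -/
lemma chartField_self [IsManifold I 1 M] (x : M) (V : Π y : M, TangentSpace I y) :
    chartField I x V (extChartAt I x x) = V x := by
  have h := mvfderiv_extChartAt_symm (φ := extChartAt I x) V (mem_extChartAt_target (I := I) x)
    (by rw [extChartAt_to_inv]; exact mdifferentiableAt_extChartAt (mem_chart_source H x))
  rw [extChartAt_to_inv, mvfderiv_of_eventuallyEq_comp_extChartAt (φ' := id) (by rfl)
    (hasFDerivAt_id _)] at h
  have h1 : extChartAt I x ∘ (extChartAt I x).symm =ᶠ[𝓝 (extChartAt I x x)] id := by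
    filter_upwards [extChartAt_target_mem_nhds (I := I) x] with z hz
    exact (extChartAt I x).right_inv hz
  rw [h1.fderiv_eq, fderiv_id] at h
  exact h.symm

lemma differentiableAt_chartField [CompleteSpace E] [IsManifold I 1 M] [IsManifold I 2 M] {x : M}
    {V : Π y : M, TangentSpace I y}
    (hV : MDifferentiableAt I I.tangent (fun y ↦ (⟨y, V y⟩ : TangentBundle I M)) x) :
    DifferentiableAt ℝ (chartField I x V) (extChartAt I x x) := by
  have h := (mdifferentiableWithinAt_univ.2 hV).differentiableWithinAt_mpullbackWithin_vectorField
  rw [Set.preimage_univ, Set.univ_inter] at h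
  have h1 : DifferentiableWithinAt ℝ (chartField I x V) (Set.range I) (extChartAt I x x) := h
  rwa [I.range_eq_univ, differentiableWithinAt_univ] at h1

lemma mlieBracket_eq_chartField [IsManifold I 1 M] (x : M) (V W : Π y : M, TangentSpace I y) :
    mlieBracket I V W x
      = fderiv ℝ (chartField I x W) (extChartAt I x x) (chartField I x V (extChartAt I x x))
        - fderiv ℝ (chartField I x V) (extChartAt I x x)
          (chartField I x W (extChartAt I x x)) := by
  have h1 : ∀ (L : E →L[ℝ] E), L = ContinuousLinearMap.id ℝ E → ∀ u : E, L.inverse u = u := by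
    rintro L rfl u
    rw [ContinuousLinearMap.inverse_id]
    rfl
  rw [← mlieBracketWithin_univ, mlieBracketWithin_apply]
  refine (h1 _ mfderiv_extChartAt_self _).trans ?_
  rw [Set.preimage_univ, Set.univ_inter]
  change lieBracketWithin ℝ (chartField I x V) (chartField I x W) (Set.range I) _ = _
  rw [I.range_eq_univ, lieBracketWithin_univ]
  rfl

lemma contDiffAt_comp_extChartAt_symm [IsManifold I 2 M] {x : M} {φ : M → F}
    (hφ : ContMDiffAt I 𝓘(ℝ, F) 2 φ x) :
    ContDiffAt ℝ 2 (φ ∘ (extChartAt I x).symm) (extChartAt I x x) := by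
  have h1 : ContMDiffAt 𝓘(ℝ, E) I 2 (extChartAt I x).symm (extChartAt I x x) := by
    have h := contMDiffWithinAt_extChartAt_symm_range (n := 2) (I := I) x
      (mem_extChartAt_target (I := I) x)
    rwa [I.range_eq_univ, contMDiffWithinAt_univ] at h
  exact (ContMDiffAt.comp_of_eq hφ h1 (extChartAt_to_inv x)).contDiffAt

lemma hasFDerivAt_mvfderiv_extChartAt_symm [CompleteSpace E] [IsManifold I 1 M] [IsManifold I 2 M]
    {x : M} {φ : M → F} {W : Π y : M, TangentSpace I y}
    (hφ : ContMDiffAt I 𝓘(ℝ, F) 2 φ x)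
    (hW : MDifferentiableAt I I.tangent (fun y ↦ (⟨y, W y⟩ : TangentBundle I M)) x) :
    HasFDerivAt (fun z ↦ fderiv ℝ (φ ∘ (extChartAt I x).symm) z (chartField I x W z))
      ((fderiv ℝ (φ ∘ (extChartAt I x).symm) (extChartAt I x x)).comp
          (fderiv ℝ (chartField I x W) (extChartAt I x x))
        + (fderiv ℝ (fderiv ℝ (φ ∘ (extChartAt I x).symm)) (extChartAt I x x)).flip
          (chartField I x W (extChartAt I x x))) (extChartAt I x x) := by
  have h1 : DifferentiableAt ℝ (fderiv ℝ (φ ∘ (extChartAt I x).symm)) (extChartAt I x x) :=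
    ((contDiffAt_comp_extChartAt_symm hφ).fderiv_right (m := 1) (by norm_num)).differentiableAt
      (by norm_num)
  exact h1.hasFDerivAt.clm_apply (differentiableAt_chartField hW).hasFDerivAt

lemma mvfderiv_apply_eventuallyEq [IsManifold I 1 M] [IsManifold I 2 M] {x : M} {φ : M → F}
    (hφ : ContMDiffAt I 𝓘(ℝ, F) 2 φ x) (W : Π y : M, TangentSpace I y) :
    (fun y ↦ mvfderiv I φ y (W y)) =ᶠ[𝓝 x]
      (fun z ↦ fderiv ℝ (φ ∘ (extChartAt I x).symm) z (chartField I x W z)) ∘ extChartAt I x := by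
  filter_upwards [extChartAt_source_mem_nhds (I := I) x, (contMDiffAt_iff_contMDiffAt_nhds (by simp)).1 hφ] with y hy hy2
  have h := mvfderiv_extChartAt_symm (φ := φ) W ((extChartAt I x).map_source hy)
    (by rw [(extChartAt I x).left_inv hy]; exact hy2.mdifferentiableAt (by norm_num))
  rw [(extChartAt I x).left_inv hy] at h
  exact h

lemma mdifferentiableAt_mvfderiv_apply [CompleteSpace E] [IsManifold I 1 M] [IsManifold I 2 M]
    {x : M} {φ : M → F} {W : Π y : M, TangentSpace I y}
    (hφ : ContMDiffAt I 𝓘(ℝ, F) 2 φ x)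
    (hW : MDifferentiableAt I I.tangent (fun y ↦ (⟨y, W y⟩ : TangentBundle I M)) x) :
    MDifferentiableAt I 𝓘(ℝ, F) (fun y ↦ mvfderiv I φ y (W y)) x :=
  (hasMFDerivAt_of_eventuallyEq_comp_extChartAt (mvfderiv_apply_eventuallyEq hφ W)
    (hasFDerivAt_mvfderiv_extChartAt_symm hφ hW)).mdifferentiableAt

/-- The Lie bracket acts on functions as the commutator of the derivations. -/
lemma mvfderiv_mlieBracket [CompleteSpace E] [IsManifold I 1 M] [IsManifold I 2 M] {x : M}
    {φ : M → F} {V W : Π y : M, TangentSpace I y}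
    (hφ : ContMDiffAt I 𝓘(ℝ, F) 2 φ x)
    (hV : MDifferentiableAt I I.tangent (fun y ↦ (⟨y, V y⟩ : TangentBundle I M)) x)
    (hW : MDifferentiableAt I I.tangent (fun y ↦ (⟨y, W y⟩ : TangentBundle I M)) x) :
    mvfderiv I φ x (mlieBracket I V W x)
      = mvfderiv I (fun y ↦ mvfderiv I φ y (W y)) x (V x)
        - mvfderiv I (fun y ↦ mvfderiv I φ y (V y)) x (W x) := by
  have h1 : ∀ u : TangentSpace I x, mvfderiv I φ x u
      = fderiv ℝ (φ ∘ (extChartAt I x).symm) (extChartAt I x x) u := by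
    refine fun u ↦ mvfderiv_of_eventuallyEq_comp_extChartAt ?_
      ((contDiffAt_comp_extChartAt_symm hφ).differentiableAt (by norm_num)).hasFDerivAt u
    filter_upwards [extChartAt_source_mem_nhds (I := I) x] with y hy
    rw [Function.comp_apply, Function.comp_apply, (extChartAt I x).left_inv hy]
  -- The second-derivative terms of the two iterated derivatives cancel by symmetry, leaving only
  -- the first-order terms that make up the bracket.
  have hs := (contDiffAt_comp_extChartAt_symm hφ).isSymmSndFDerivAt (by simp)
    (chartField I x V (extChartAt I x x)) (chartField I x W (extChartAt I x x))
  rw [mvfderiv_of_eventuallyEq_comp_extChartAt (mvfderiv_apply_eventuallyEq hφ W)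
      (hasFDerivAt_mvfderiv_extChartAt_symm hφ hW),
    mvfderiv_of_eventuallyEq_comp_extChartAt (mvfderiv_apply_eventuallyEq hφ V)
      (hasFDerivAt_mvfderiv_extChartAt_symm hφ hV), h1, mlieBracket_eq_chartField,
    ← chartField_self x V, ← chartField_self x W]
  simp only [add_apply, ContinuousLinearMap.comp_apply,
    ContinuousLinearMap.flip_apply, map_sub]
  rw [hs]
  abel

/-- A vector field is differentiable if its components in the preferred chart are. -/
lemma mdifferentiableAt_of_mvfderiv_extChartAt [IsManifold I 1 M] {x : M}
    {V : Π y : M, TangentSpace I y}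
    (h : MDifferentiableAt I 𝓘(ℝ, E) (fun y ↦ mvfderiv I (extChartAt I x) y (V y)) x) :
    MDifferentiableAt I I.tangent (fun y ↦ (⟨y, V y⟩ : TangentBundle I M)) x := by
  refine (mdifferentiableAt_totalSpace ..).2 ⟨mdifferentiableAt_id, ?_⟩
  refine h.congr_of_eventuallyEq ?_
  filter_upwards [(chartAt H x).open_source.mem_nhds (mem_chart_source H x)] with y hy
  -- Over the chart domain the trivialization of the tangent bundle is the differential of the
  -- chart.
  have h1 := TangentBundle.continuousLinearMapAt_trivializationAt (𝕜 := ℝ) (I := I) hy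
  have h2 := congrArg (fun L ↦ L (V y)) h1
  rw [Trivialization.continuousLinearMapAt_apply, Trivialization.linearMapAt_apply,
    if_pos (by simpa using hy)] at h2
  exact h2

lemma mdifferentiableAt_mvfderiv_extChartAt [IsManifold I 1 M] {x : M}
    {V : Π y : M, TangentSpace I y}
    (h : MDifferentiableAt I I.tangent (fun y ↦ (⟨y, V y⟩ : TangentBundle I M)) x) :
    MDifferentiableAt I 𝓘(ℝ, E) (fun y ↦ mvfderiv I (extChartAt I x) y (V y)) x := by
  refine ((mdifferentiableAt_totalSpace ..).1 h).2.congr_of_eventuallyEq ?_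
  filter_upwards [(chartAt H x).open_source.mem_nhds (mem_chart_source H x)] with y hy
  have h1 := TangentBundle.continuousLinearMapAt_trivializationAt (𝕜 := ℝ) (I := I) hy
  have h2 := congrArg (fun L ↦ L (V y)) h1
  rw [Trivialization.continuousLinearMapAt_apply, Trivialization.linearMapAt_apply,
    if_pos (by simpa using hy)] at h2
  exact h2.symm

end Manifold

end

section

/-! ### The Koszul formula -/

section Koszul

variable {E : Type*} [NormedAddCommGroup E] [NormedSpace ℝ E]
  {H : Type*} [TopologicalSpace H] {I : ModelWithCorners ℝ E H}
  {M : Type*} [TopologicalSpace M] [ChartedSpace H M] [IsManifold I 1 M]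

/-- Each bracket is a difference of covariant derivatives, so symmetry and compatibility with
subtraction in the first slot are all that is asked of `G`. Nondegeneracy matters only when a vector
is recovered from its inner products. -/
lemma IsLeviCivita.koszul {G : ∀ x : M, TangentSpace I x → TangentSpace I x → ℝ}
    {cov : CovariantDerivative I E (TangentSpace I : M → Type _)} (h : IsLeviCivita G cov)
    (hsymm : ∀ x u v, G x u v = G x v u)
    (hsub : ∀ x u v w, G x (u - v) w = G x u w - G x v w) {x : M}
    {X Y Z : Π y : M, TangentSpace I y}
    (hX : MDifferentiableAt I I.tangent (fun y ↦ (⟨y, X y⟩ : TangentBundle I M)) x)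
    (hY : MDifferentiableAt I I.tangent (fun y ↦ (⟨y, Y y⟩ : TangentBundle I M)) x)
    (hZ : MDifferentiableAt I I.tangent (fun y ↦ (⟨y, Z y⟩ : TangentBundle I M)) x) :
    2 * G x (cov Y x (X x)) (Z x) =
      mvfderiv I (fun y ↦ G y (Y y) (Z y)) x (X x) + mvfderiv I (fun y ↦ G y (X y) (Z y)) x (Y x)
        - mvfderiv I (fun y ↦ G y (X y) (Y y)) x (Z x)
        + G x (mlieBracket I X Y x) (Z x) - G x (mlieBracket I X Z x) (Y x)
        - G x (mlieBracket I Y Z x) (X x) := by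
  rw [h.metric x _ Y Z hY hZ, h.metric x _ X Z hX hZ, h.metric x _ X Y hX hY,
    ← h.torsion_free x X Y hX hY, ← h.torsion_free x X Z hX hZ, ← h.torsion_free x Y Z hY hZ,
    hsub, hsub, hsub, hsymm x (Y x) (cov Z x (X x)), hsymm x (X x) (cov Z x (Y x)),
    hsymm x (X x) (cov Y x (Z x))]
  ring

end Koszul

/-! ### Smooth frames and the regularity of the Levi-Civita connection. -/

variable {E : Type*} [NormedAddCommGroup E] [NormedSpace ℝ E]
  {M : Type*} [TopologicalSpace M] [ChartedSpace E M] [IsManifold 𝓘(ℝ, E) ∞ M]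

/-- The vector field `Z` is of class `C^n` at `x`. -/
abbrev CDiffFieldAt (n : ℕ∞ω) (Z : Π y : M, TangentSpace 𝓘(ℝ, E) y) (x : M) : Prop :=
  ContMDiffAt 𝓘(ℝ, E) 𝓘(ℝ, E).tangent n (fun y ↦ (⟨y, Z y⟩ : TangentBundle 𝓘(ℝ, E) M)) x

/-- The vector field `Z` is differentiable at `x`. -/
abbrev DiffFieldAt (Z : Π y : M, TangentSpace 𝓘(ℝ, E) y) (x : M) : Prop :=
  MDifferentiableAt 𝓘(ℝ, E) 𝓘(ℝ, E).tangent
    (fun y ↦ (⟨y, Z y⟩ : TangentBundle 𝓘(ℝ, E) M)) x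

lemma contMDiffAt_inner (g : Metric E M) {n : ℕ∞ω} (hn : n ≤ ∞)
    {A B : Π y : M, TangentSpace 𝓘(ℝ, E) y} {x : M}
    (hA : CDiffFieldAt n A x) (hB : CDiffFieldAt n B x) :
    ContMDiffAt 𝓘(ℝ, E) 𝓘(ℝ, ℝ) n (fun y ↦ g.inner y (A y) (B y)) x := by
  have h := ContMDiffAt.clm_bundle_apply₂ (F₃ := ℝ) (E₃ := Bundle.Trivial M ℝ)
    (b := fun y : M ↦ y) (ψ := fun y ↦ g.inner y) ((g.contMDiff x).of_le hn) hA hB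
  exact (contMDiffAt_totalSpace.1 h).2

lemma mdifferentiableAt_inner (g : Metric E M)
    {A B : Π y : M, TangentSpace 𝓘(ℝ, E) y} {x : M}
    (hA : DiffFieldAt A x) (hB : DiffFieldAt B x) :
    MDifferentiableAt 𝓘(ℝ, E) 𝓘(ℝ, ℝ) (fun y ↦ g.inner y (A y) (B y)) x := by
  have h := MDifferentiableAt.clm_bundle_apply₂ (F₃ := ℝ) (E₃ := Bundle.Trivial M ℝ)
    (b := fun y : M ↦ y) (ψ := fun y ↦ g.inner y)
    ((g.contMDiff x).mdifferentiableAt (by simp)) hA hB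
  exact ((mdifferentiableAt_totalSpace ..).1 h).2

lemma contMDiffAt_coordField (x : M) (w : TangentSpace 𝓘(ℝ, E) x) {y : M}
    (hy : y ∈ (trivializationAt E (TangentSpace 𝓘(ℝ, E) : M → Type _) x).baseSet) :
    CDiffFieldAt ∞ (coordField x w) y := by
  refine ((trivializationAt E (TangentSpace 𝓘(ℝ, E) : M → Type _) x).contMDiffAt_section_iff hy).2 ?_
  refine (contMDiffAt_const (I := 𝓘(ℝ, E)) (I' := 𝓘(ℝ, E)) (M' := E) (c := w)).congr_of_eventuallyEq ?_
  filter_upwards [(trivializationAt E (TangentSpace 𝓘(ℝ, E) : M → Type _)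
    x).open_baseSet.mem_nhds hy] with z hz
  exact (congrArg (fun u ↦ (trivializationAt E (TangentSpace 𝓘(ℝ, E) : M → Type _) x ⟨z, u⟩).2)
    (Trivialization.symmL_apply _ hz w)).trans (congrArg Prod.snd
    ((trivializationAt E (TangentSpace 𝓘(ℝ, E) : M → Type _) x).apply_mk_symm hz (w : E)))

variable [FiniteDimensional ℝ E]

lemma coordField_basis (x : M) {ι : Type*} (b : Module.Basis ι ℝ E) (i : ι) {y : M}
    (hy : y ∈ (trivializationAt E (TangentSpace 𝓘(ℝ, E) : M → Type _) x).baseSet) :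
    coordField x (b i) y = (trivializationAt E (TangentSpace 𝓘(ℝ, E) : M → Type _) x).basisAt b hy i := by
  unfold coordField
  rw [Trivialization.symmL_apply _ hy]
  simp [Trivialization.basisAt]

/-- The matrix of the metric in a coordinate frame. -/
def gram (g : Metric E M) (x : M) {ι : Type*} (b : Module.Basis ι ℝ E) (y : M) : Matrix ι ι ℝ :=
  Matrix.of fun i j ↦ g.inner y (coordField x (b i) y) (coordField x (b j) y)

/-- A vector in the kernel would give a tangent vector orthogonal to the whole frame, hence to
itself. -/
lemma gram_det_ne_zero (g : Metric E M) (x : M) {ι : Type*} [Fintype ι] [DecidableEq ι]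
    (b : Module.Basis ι ℝ E) {y : M}
    (hy : y ∈ (trivializationAt E (TangentSpace 𝓘(ℝ, E) : M → Type _) x).baseSet) :
    (gram g x b y).det ≠ 0 := by
  intro h0
  obtain ⟨v, hv, h1⟩ := Matrix.exists_vecMul_eq_zero_iff.2 h0
  set B := (trivializationAt E (TangentSpace 𝓘(ℝ, E) : M → Type _) x).basisAt b hy with hB
  have h2 : ∀ j, g.inner y (∑ i, v i • B i) (B j) = 0 := by
    intro j
    have h3 := congrFun h1 j
    simp only [Matrix.vecMul, dotProduct, gram, Matrix.of_apply, Pi.zero_apply,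
      coordField_basis x b _ hy] at h3
    rw [map_sum, sum_apply]
    simpa using h3
  obtain ⟨u, hu⟩ : ∃ u, u = ∑ i, v i • B i := ⟨_, rfl⟩
  rw [← hu] at h2
  have h4 : g.inner y u u = 0 := by
    rw [hu, map_sum, ← hu]
    simp [h2]
  have h5 : ∑ i, v i • B i = 0 := by
    rw [← hu]
    by_contra hne
    exact (g.pos y _ hne).ne' h4
  exact hv (funext fun i ↦ Fintype.linearIndependent_iff.1 B.linearIndependent v h5 i)

lemma contMDiffAt_det {n : ℕ∞ω} {ι : Type*} [Fintype ι] [DecidableEq ι]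
    {A : M → Matrix ι ι ℝ} {x : M}
    (hA : ∀ i j, ContMDiffAt 𝓘(ℝ, E) 𝓘(ℝ, ℝ) n (fun y ↦ A y i j) x) :
    ContMDiffAt 𝓘(ℝ, E) 𝓘(ℝ, ℝ) n (fun y ↦ (A y).det) x := by
  simp only [Matrix.det_apply]
  refine ContMDiffAt.sum fun σ _ ↦ ?_
  have h : ContMDiffAt 𝓘(ℝ, E) 𝓘(ℝ, ℝ) n (fun y ↦ ∏ i, A y (σ i) i) x :=
    contMDiffAt_finsetProd fun i _ ↦ hA _ _
  exact (contMDiffAt_const (c := ((Equiv.Perm.sign σ : ℤ) : ℝ))).mul h |>.congr_of_eventuallyEq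
    (Eventually.of_forall fun y ↦ by simp [Units.smul_def])

lemma contMDiffAt_matrix_inv {n : ℕ∞ω} {ι : Type*} [Fintype ι] [DecidableEq ι]
    {A : M → Matrix ι ι ℝ} {x : M} (hx : (A x).det ≠ 0)
    (hA : ∀ i j, ContMDiffAt 𝓘(ℝ, E) 𝓘(ℝ, ℝ) n (fun y ↦ A y i j) x) (i j : ι) :
    ContMDiffAt 𝓘(ℝ, E) 𝓘(ℝ, ℝ) n (fun y ↦ (A y)⁻¹ i j) x := by
  have h : ContMDiffAt 𝓘(ℝ, E) 𝓘(ℝ, ℝ) n (fun y ↦ (A y).adjugate i j) x := by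
    simp only [Matrix.adjugate_apply]
    refine contMDiffAt_det fun k l ↦ ?_
    by_cases hk : k = j
    · simp only [Matrix.updateRow_apply, if_pos hk]
      exact contMDiffAt_const
    · simp only [Matrix.updateRow_apply, if_neg hk]
      exact hA k l
  have h1 := (contMDiffAt_det hA).inv₀ hx
  refine (h1.mul h).congr_of_eventuallyEq (Eventually.of_forall fun y ↦ ?_)
  simp [Matrix.inv_def]

/-- Take `ε_i = g^{ik} ∂_k`, smooth by Cramer's rule. It turns inner products with coordinate fields
into components, so the regularity of a field becomes that of finitely many functions; it also gives
a local formula for `α`. -/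
lemma exists_dual_frame (g : Metric E M) (x : M) {ι : Type*} [Fintype ι] [DecidableEq ι]
    (b : Module.Basis ι ℝ E) :
    ∃ ε : ι → Π y : M, TangentSpace 𝓘(ℝ, E) y, (∀ i, CDiffFieldAt ∞ (ε i) x) ∧
      ∀ᶠ y in 𝓝 x, ∀ u : TangentSpace 𝓘(ℝ, E) y,
        u = ∑ i, g.inner y u (coordField x (b i) y) • ε i y := by
  set t := trivializationAt E (TangentSpace 𝓘(ℝ, E) : M → Type _) x with ht
  have hx : x ∈ t.baseSet := FiberBundle.mem_baseSet_trivializationAt' x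
  refine ⟨fun i y ↦ ∑ k, (gram g x b y)⁻¹ i k • coordField x (b k) y, fun i ↦ ?_, ?_⟩
  · refine ContMDiffAt.sum_section fun k _ ↦ ?_
    refine ContMDiffAt.smul_section ?_ (contMDiffAt_coordField x _ hx)
    exact contMDiffAt_matrix_inv (gram_det_ne_zero g x b hx) (fun i j ↦ contMDiffAt_inner g le_rfl
      (contMDiffAt_coordField x _ hx) (contMDiffAt_coordField x _ hx)) i k
  · filter_upwards [t.open_baseSet.mem_nhds hx] with y hy u
    set B := t.basisAt b hy with hB
    have h1 : (fun i ↦ g.inner y u (coordField x (b i) y))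
        = Matrix.vecMul (fun k ↦ B.repr u k) (gram g x b y) := by
      funext j
      simp only [Matrix.vecMul, dotProduct, gram, Matrix.of_apply, coordField_basis x b _ hy]
      conv_lhs => rw [← B.sum_repr u]
      rw [map_sum, sum_apply]
      simp [hB, ht]
    have h2 : Matrix.vecMul (fun i ↦ g.inner y u (coordField x (b i) y)) (gram g x b y)⁻¹
        = fun k ↦ B.repr u k := by
      rw [h1, Matrix.vecMul_vecMul,
        Matrix.mul_nonsing_inv _ (isUnit_iff_ne_zero.2 (gram_det_ne_zero g x b hy)),
        Matrix.vecMul_one]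
    conv_lhs => rw [← B.sum_repr u]
    simp only [Finset.smul_sum]
    rw [Finset.sum_comm]
    refine Finset.sum_congr rfl fun k _ ↦ ?_
    rw [← congrFun h2 k, coordField_basis x b _ hy, ← hB]
    simp only [Matrix.vecMul, dotProduct, Finset.sum_smul, smul_smul]

/-- A vector field is `C^n` if its inner products with a coordinate frame are. -/
lemma cdiffFieldAt_of_inner (g : Metric E M) {n : ℕ∞ω} (hn : n ≤ ∞) {x : M} {ι : Type*} [Fintype ι]
    (b : Module.Basis ι ℝ E) {A : Π y : M, TangentSpace 𝓘(ℝ, E) y}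
    (h : ∀ i, ContMDiffAt 𝓘(ℝ, E) 𝓘(ℝ, ℝ) n (fun y ↦ g.inner y (A y) (coordField x (b i) y)) x) :
    CDiffFieldAt n A x := by
  classical
  obtain ⟨ε, hε, hA⟩ := exists_dual_frame g x b
  have h1 : CDiffFieldAt n
      (fun y ↦ ∑ i, g.inner y (A y) (coordField x (b i) y) • ε i y) x :=
    ContMDiffAt.sum_section fun i _ ↦ ContMDiffAt.smul_section (h i) ((hε i).of_le hn)
  refine h1.congr_of_eventuallyEq ?_
  filter_upwards [hA] with y hy
  exact congrArg (fun u ↦ (⟨y, u⟩ : TangentBundle 𝓘(ℝ, E) M)) (hy (A y))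

lemma two_le_infty : (2 : ℕ∞ω) ≤ ∞ := WithTop.coe_le_coe.2 (le_top (a := (2 : ℕ∞)))

lemma one_le_infty : (1 : ℕ∞ω) ≤ ∞ := by exact_mod_cast le_top

lemma CDiffFieldAt.eventually {Z : Π y : M, TangentSpace 𝓘(ℝ, E) y} {x : M}
    (h : CDiffFieldAt 2 Z x) : ∀ᶠ y in 𝓝 x, CDiffFieldAt 2 Z y := by
  -- The tangent bundle loses one degree of smoothness, so a `C^2` field calls for a `C^3` base.
  have : IsManifold 𝓘(ℝ, E) (2 + 1) M :=
    IsManifold.of_le (n := ∞) (WithTop.coe_le_coe.2 (le_top (a := (3 : ℕ∞))))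
  exact (contMDiffAt_iff_contMDiffAt_nhds (by simp)).1 h

lemma CDiffFieldAt.diffFieldAt {n : ℕ∞ω} (hn : 1 ≤ n) {Z : Π y : M, TangentSpace 𝓘(ℝ, E) y} {x : M}
    (h : CDiffFieldAt n Z x) : DiffFieldAt Z x :=
  h.mdifferentiableAt (by rintro rfl; simp at hn)

lemma contMDiffAt_mvfderiv_apply {φ : M → ℝ} {Z : Π y : M, TangentSpace 𝓘(ℝ, E) y} {x : M}
    (hφ : ContMDiffAt 𝓘(ℝ, E) 𝓘(ℝ, ℝ) 2 φ x) (hZ : CDiffFieldAt 1 Z x) :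
    ContMDiffAt 𝓘(ℝ, E) 𝓘(ℝ, ℝ) 1 (fun y ↦ mvfderiv 𝓘(ℝ, E) φ y (Z y)) x := by
  have h1 := hφ.mfderiv_const (m := 1) (by norm_num)
  have h2 := ContMDiffAt.clm_apply_of_inCoordinates (n := 1) (b₁ := id) (b₂ := φ)
    (ϕ := fun y ↦ mfderiv 𝓘(ℝ, E) 𝓘(ℝ, ℝ) φ y) h1 hZ (hφ.of_le (by norm_num))
  exact (contMDiff_snd_tangentBundle_modelSpace ℝ 𝓘(ℝ, ℝ)).contMDiffAt.comp x h2

lemma cdiffFieldAt_mlieBracket {Y Z : Π y : M, TangentSpace 𝓘(ℝ, E) y} {x : M}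
    (hY : CDiffFieldAt 2 Y x) (hZ : CDiffFieldAt 2 Z x) :
    CDiffFieldAt 1 (mlieBracket 𝓘(ℝ, E) Y Z) x := by
  have : IsManifold 𝓘(ℝ, E) (minSmoothness ℝ 2) M := by
    rw [minSmoothness_of_isRCLikeNormedField]
    infer_instance
  have : IsManifold 𝓘(ℝ, E) ((2 : ℕ∞) + 1) M :=
    IsManifold.of_le (n := ∞) (by exact_mod_cast le_top)
  refine ContMDiffAt.mlieBracket_vectorField (n := 2) (m := 1) hY hZ ?_
  rw [minSmoothness_of_isRCLikeNormedField]
  norm_num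

/-- A Levi-Civita connection is of class `C^1`. -/
lemma cdiffFieldAt_cov (g : Metric E M) {cov : Connection E M}
    (hcov : IsLeviCivita (fun x u v ↦ g.inner x u v) cov) {Y Z : Π y : M, TangentSpace 𝓘(ℝ, E) y}
    {x : M} (hY : CDiffFieldAt 2 Y x) (hZ : CDiffFieldAt 2 Z x) :
    CDiffFieldAt 1 (fun y ↦ cov Z y (Y y)) x := by
  -- The Koszul formula expresses the inner products with coordinate fields by first derivatives and
  -- brackets of `C^2` data, which are `C^1`.
  refine cdiffFieldAt_of_inner g one_le_infty (Module.finBasis ℝ E) fun i ↦ ?_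
  set W := coordField x (Module.finBasis ℝ E i) with hW
  have hW' : CDiffFieldAt 2 W x := (contMDiffAt_coordField x _
    (FiberBundle.mem_baseSet_trivializationAt' x)).of_le two_le_infty
  have h12 : (1 : ℕ∞ω) ≤ 2 := by norm_num
  have h : ContMDiffAt 𝓘(ℝ, E) 𝓘(ℝ, ℝ) 1 (fun y ↦ (1 / 2 : ℝ) * (
      mvfderiv 𝓘(ℝ, E) (fun y ↦ g.inner y (Z y) (W y)) y (Y y)
        + mvfderiv 𝓘(ℝ, E) (fun y ↦ g.inner y (Y y) (W y)) y (Z y)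
        - mvfderiv 𝓘(ℝ, E) (fun y ↦ g.inner y (Y y) (Z y)) y (W y)
        + g.inner y (mlieBracket 𝓘(ℝ, E) Y Z y) (W y)
        - g.inner y (mlieBracket 𝓘(ℝ, E) Y W y) (Z y)
        - g.inner y (mlieBracket 𝓘(ℝ, E) Z W y) (Y y))) x := by
    refine contMDiffAt_const.mul ?_
    have i1 := contMDiffAt_inner g two_le_infty hZ hW'
    have i2 := contMDiffAt_inner g two_le_infty hY hW'
    have i3 := contMDiffAt_inner g two_le_infty hY hZ
    exact (((((contMDiffAt_mvfderiv_apply i1 (hY.of_le h12)).add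
      (contMDiffAt_mvfderiv_apply i2 (hZ.of_le h12))).sub
      (contMDiffAt_mvfderiv_apply i3 (hW'.of_le h12))).add
      (contMDiffAt_inner g one_le_infty (cdiffFieldAt_mlieBracket hY hZ) (hW'.of_le h12))).sub
      (contMDiffAt_inner g one_le_infty (cdiffFieldAt_mlieBracket hY hW') (hZ.of_le h12))).sub
      (contMDiffAt_inner g one_le_infty (cdiffFieldAt_mlieBracket hZ hW') (hY.of_le h12))
  refine h.congr_of_eventuallyEq ?_
  filter_upwards [hY.eventually, hZ.eventually, hW'.eventually]
    with y h1 h2 h3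
  have k := hcov.koszul (fun x u v ↦ g.symm x u v) (fun x u v w ↦ by simp)
    (h1.diffFieldAt h12) (h2.diffFieldAt h12) (h3.diffFieldAt h12)
  rw [← k]
  ring

end

section

variable {E : Type*} [NormedAddCommGroup E] [NormedSpace ℝ E]
  {M : Type*} [TopologicalSpace M] [ChartedSpace E M] [IsManifold 𝓘(ℝ, E) ∞ M]

/-! ### The cotangent bundle as a manifold -/

/-- The fibre coordinates are `p_i = p(∂_i)`, so the chart of `T*M` consists of base coordinates and
evaluations on coordinate fields. This is why evaluations on fields suffice as test functions. -/
lemma extChartAt_cotangent_snd (p q : CotangentBundle E M) (w : E) :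
    (extChartAt (cotModel E) p q).2 w = q.2 (coordField p.proj w q.proj) := by
  have h : (extChartAt (cotModel E) p q).2 = ContinuousLinearMap.inCoordinates E
      (TangentSpace 𝓘(ℝ, E)) ℝ (Bundle.Trivial M ℝ) p.proj q.proj p.proj q.proj q.2 := by
    rw [FiberBundle.extChartAt]
    exact congrArg Prod.snd (hom_trivializationAt_apply (σ := RingHom.id ℝ) (F₁ := E)
      (E₁ := TangentSpace 𝓘(ℝ, E)) (F₂ := ℝ) (E₂ := Bundle.Trivial M ℝ) p.proj q)
  have h1 := Bundle.Trivial.continuousLinearMapAt_trivialization ℝ M ℝ q.proj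
  rw [h, ContinuousLinearMap.inCoordinates]
  exact congrArg (fun L : ℝ →L[ℝ] ℝ ↦ L (q.2 (coordField p.proj w q.proj))) h1

/-- The function `p ↦ p(Z)` on `T*M` that a vector field `Z` on `M` defines. -/
def liftEval (Z : Π y : M, TangentSpace 𝓘(ℝ, E) y) (q : CotangentBundle E M) : ℝ :=
  q.2 (Z q.proj)

lemma contMDiffAt_proj (n : ℕ∞ω) (p : CotangentBundle E M) :
    ContMDiffAt (cotModel E) 𝓘(ℝ, E) n (fun q : CotangentBundle E M ↦ q.proj) p :=
  Bundle.contMDiffAt_proj _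

lemma contMDiffAt_liftEval {n : ℕ∞ω} {Z : Π y : M, TangentSpace 𝓘(ℝ, E) y}
    {p : CotangentBundle E M} (hZ : CDiffFieldAt n Z p.proj) :
    ContMDiffAt (cotModel E) 𝓘(ℝ, ℝ) n (liftEval Z) p := by
  have h1 : ContMDiffAt (cotModel E) (cotModel E) n (fun q : CotangentBundle E M ↦
      (⟨q.proj, q.2⟩ : CotangentBundle E M)) p := contMDiffAt_id
  have h2 : ContMDiffAt (cotModel E) 𝓘(ℝ, E).tangent n (fun q : CotangentBundle E M ↦
      (⟨q.proj, Z q.proj⟩ : TangentBundle 𝓘(ℝ, E) M)) p :=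
    ContMDiffAt.comp p hZ (contMDiffAt_proj n p)
  have h := ContMDiffAt.clm_bundle_apply (F₂ := ℝ) (E₂ := Bundle.Trivial M ℝ)
    (b := fun q : CotangentBundle E M ↦ q.proj) (ϕ := fun q ↦ q.2) h1 h2
  exact (contMDiffAt_totalSpace.1 h).2

lemma mdifferentiableAt_liftEval {Z : Π y : M, TangentSpace 𝓘(ℝ, E) y}
    {p : CotangentBundle E M} (hZ : DiffFieldAt Z p.proj) :
    MDifferentiableAt (cotModel E) 𝓘(ℝ, ℝ) (liftEval Z) p := by
  have h1 : MDifferentiableAt (cotModel E) (cotModel E) (fun q : CotangentBundle E M ↦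
      (⟨q.proj, q.2⟩ : CotangentBundle E M)) p := mdifferentiableAt_id
  have h2 : MDifferentiableAt (cotModel E) 𝓘(ℝ, E).tangent (fun q : CotangentBundle E M ↦
      (⟨q.proj, Z q.proj⟩ : TangentBundle 𝓘(ℝ, E) M)) p :=
    MDifferentiableAt.comp p hZ ((contMDiffAt_proj 1 p).mdifferentiableAt (by simp))
  have h := MDifferentiableAt.clm_bundle_apply (F₂ := ℝ) (E₂ := Bundle.Trivial M ℝ)
    (b := fun q : CotangentBundle E M ↦ q.proj) (ϕ := fun q ↦ q.2) h1 h2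
  exact ((mdifferentiableAt_totalSpace ..).1 h).2

variable [FiniteDimensional ℝ E]

/-- In the preferred charts at `p` and `p.proj` the bundle projection is the first factor
projection. -/
lemma mfderiv_proj (p : CotangentBundle E M) (ξ : TangentSpace (cotModel E) p) :
    mfderiv (cotModel E) 𝓘(ℝ, E) (fun q : CotangentBundle E M ↦ q.proj) p ξ = hPart p ξ := by
  have h1 : MDifferentiableAt (cotModel E) 𝓘(ℝ, E) (fun q : CotangentBundle E M ↦ q.proj) p :=
    (contMDiffAt_proj 1 p).mdifferentiableAt (by simp)
  have h2 := mdifferentiableAt_extChartAt (I := 𝓘(ℝ, E)) (mem_chart_source E p.proj)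
  have h3 := mfderiv_comp p h2 h1
  have h4 := mvfderiv_of_eventuallyEq_comp_extChartAt (I := cotModel E)
    (φ := extChartAt 𝓘(ℝ, E) p.proj ∘ fun q : CotangentBundle E M ↦ q.proj) (x := p)
    (φ' := Prod.fst) (Filter.Eventually.of_forall fun q ↦ rfl) hasFDerivAt_fst ξ
  rw [mfderiv_extChartAt_self] at h3
  have h5 := congrArg (fun L : (E × (E →L[ℝ] ℝ)) →L[ℝ] E ↦ L ξ) h3
  exact h5.symm.trans h4

/-- The derivative of a function that is pulled back from `M`. -/
lemma mvfderiv_comp_proj {F : Type*} [NormedAddCommGroup F] [NormedSpace ℝ F] {φ : M → F}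
    {p : CotangentBundle E M} (hφ : MDifferentiableAt 𝓘(ℝ, E) 𝓘(ℝ, F) φ p.proj)
    (ξ : TangentSpace (cotModel E) p) :
    mvfderiv (cotModel E) (fun q : CotangentBundle E M ↦ φ q.proj) p ξ
      = mvfderiv 𝓘(ℝ, E) φ p.proj (hPart p ξ) := by
  have h1 : MDifferentiableAt (cotModel E) 𝓘(ℝ, E) (fun q : CotangentBundle E M ↦ q.proj) p :=
    (contMDiffAt_proj 1 p).mdifferentiableAt (by simp)
  have h3 := mfderiv_comp p hφ h1
  have h5 := congrArg (fun L : (E × (E →L[ℝ] ℝ)) →L[ℝ] F ↦ L ξ) h3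
  exact h5.trans (congrArg (mfderiv 𝓘(ℝ, E) 𝓘(ℝ, F) φ p.proj) (mfderiv_proj p ξ))

lemma mvfderiv_liftEval_coordField (p : CotangentBundle E M) (w : E)
    (ξ : TangentSpace (cotModel E) p) :
    mvfderiv (cotModel E) (liftEval (coordField p.proj w)) p ξ
      = (show E × (E →L[ℝ] ℝ) from ξ).2 w := by
  refine mvfderiv_of_eventuallyEq_comp_extChartAt (I := cotModel E)
    (φ' := fun z ↦ z.2 w) (D := (ContinuousLinearMap.apply ℝ ℝ w).comp
      (ContinuousLinearMap.snd ℝ E (E →L[ℝ] ℝ))) ?_ ?_ ξ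
  · exact Filter.Eventually.of_forall fun q ↦ (extChartAt_cotangent_snd p q w).symm
  · exact ((ContinuousLinearMap.apply ℝ ℝ w).comp
      (ContinuousLinearMap.snd ℝ E (E →L[ℝ] ℝ))).hasFDerivAt

/-- The derivative of `p ↦ p(Z)` along a tangent vector of `T*M`. -/
lemma mvfderiv_liftEval (cov : Connection E M) {Z : Π y : M, TangentSpace 𝓘(ℝ, E) y}
    {p : CotangentBundle E M} (hZ : DiffFieldAt Z p.proj) (ξ : TangentSpace (cotModel E) p) :
    mvfderiv (cotModel E) (liftEval Z) p ξ
      = p.2 (cov Z p.proj (hPart p ξ)) + vPart cov p ξ (Z p.proj) := by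
  -- Replacing `W` by `fW` adds the same term `df(u) p(W)` to both summands, `u` being the
  -- horizontal part of `ξ`. Hence `Z` may be exchanged for the coordinate field with the same value
  -- at the base point, where the claim is the definition of `vPart` through Christoffel symbols.
  have key : TensorialAt 𝓘(ℝ, E) E (fun W : (Π y : M, TangentSpace 𝓘(ℝ, E) y) ↦
      mvfderiv (cotModel E) (liftEval W) p ξ - p.2 (cov W p.proj (hPart p ξ))) p.proj := by
    constructor
    · intro f W hf hW
      have h1 := cov.isCovariantDerivativeOnUniv.leibniz hW hf
      have h2 : liftEval (f • W) = fun q : CotangentBundle E M ↦ f q.proj * liftEval W q := by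
        funext y; simp [liftEval]
      have h3 : MDifferentiableAt (cotModel E) 𝓘(ℝ, ℝ) (fun q : CotangentBundle E M ↦ f q.proj) p :=
        MDifferentiableAt.comp p hf ((contMDiffAt_proj 1 p).mdifferentiableAt (by simp))
      rw [h1, h2, mvfderiv_fun_mul h3 (mdifferentiableAt_liftEval hW)]
      simp only [add_apply, smul_apply, mvfderiv_comp_proj hf]
      simp [liftEval]
      ring
    · intro W W' hW hW'
      have h1 := cov.isCovariantDerivativeOnUniv.add hW hW'
      have h2 : liftEval (W + W') = fun q : CotangentBundle E M ↦ liftEval W q + liftEval W' q := by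
        funext y; simp [liftEval]
      rw [h1, h2, mvfderiv_fun_add (mdifferentiableAt_liftEval hW) (mdifferentiableAt_liftEval hW')]
      simp
      ring
  have h := key.pointwise hZ (mdifferentiableAt_coordField p.proj (Z p.proj))
    (coordField_self p.proj (Z p.proj)).symm
  have h2 : vPart cov p ξ (Z p.proj) = (show E × (E →L[ℝ] ℝ) from ξ).2 (Z p.proj)
      - p.2 (cov (coordField p.proj (Z p.proj)) p.proj (hPart p ξ)) := rfl
  have h3 := mvfderiv_liftEval_coordField p (Z p.proj) ξ
  rw [h2, ← h3]
  linarith [h]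

end

/-! ### Lifted fields on the cotangent bundle and their differentiability. -/

section

variable {E : Type*} [NormedAddCommGroup E] [NormedSpace ℝ E]
  {M : Type*} [TopologicalSpace M] [ChartedSpace E M] [IsManifold 𝓘(ℝ, E) ∞ M]
  [FiniteDimensional ℝ E]

/-- The vector field `Ξ` on `T*M` is differentiable at `p`. -/
abbrev CotDiffFieldAt (Ξ : Π q : CotangentBundle E M, TangentSpace (cotModel E) q)
    (p : CotangentBundle E M) : Prop :=
  MDifferentiableAt (cotModel E) (cotModel E).tangent
    (fun q ↦ (⟨q, Ξ q⟩ : TangentBundle (cotModel E) (CotangentBundle E M))) p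

/-- The horizontal lift of a vector field. -/
def hField (cov : Connection E M) (Z : Π y : M, TangentSpace 𝓘(ℝ, E) y)
    (q : CotangentBundle E M) : TangentSpace (cotModel E) q :=
  hLift cov q (Z q.proj)

/-- The vertical lift of the one-form that is dual to a vector field. -/
def vField (g : Metric E M) (A : Π y : M, TangentSpace 𝓘(ℝ, E) y)
    (q : CotangentBundle E M) : TangentSpace (cotModel E) q :=
  vLift q (g.inner q.proj (A q.proj))

lemma mdifferentiableAt_comp_proj {F : Type*} [NormedAddCommGroup F] [NormedSpace ℝ F] {φ : M → F}
    {p : CotangentBundle E M} (hφ : MDifferentiableAt 𝓘(ℝ, E) 𝓘(ℝ, F) φ p.proj) :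
    MDifferentiableAt (cotModel E) 𝓘(ℝ, F) (fun q : CotangentBundle E M ↦ φ q.proj) p :=
  MDifferentiableAt.comp p hφ ((contMDiffAt_proj 1 p).mdifferentiableAt (by simp))

lemma mdifferentiableAt_dual {H N EN : Type*} [NormedAddCommGroup EN] [NormedSpace ℝ EN]
    [TopologicalSpace H] {I : ModelWithCorners ℝ EN H} [TopologicalSpace N] [ChartedSpace H N]
    {c : N → (E →L[ℝ] ℝ)} {x : N}
    (h : ∀ w, MDifferentiableAt I 𝓘(ℝ, ℝ) (fun y ↦ c y w) x) :
    MDifferentiableAt I 𝓘(ℝ, E →L[ℝ] ℝ) c x := by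
  set b := Module.finBasis ℝ E
  have h1 : c = ∑ i, fun y ↦ ContinuousLinearMap.toSpanSingleton ℝ
      (LinearMap.toContinuousLinearMap (b.coord i)) (c y (b i)) := by
    funext y
    ext w
    conv_lhs => rw [← b.sum_repr w, map_sum]
    simp [mul_comm]
  rw [h1]
  exact MDifferentiableAt.sum fun i _ ↦ (ContinuousLinearMap.mdifferentiableAt _).comp x (h (b i))

lemma mvfderiv_clm_comp {EN H N F F' : Type*} [NormedAddCommGroup EN] [NormedSpace ℝ EN]
    [NormedAddCommGroup F] [NormedSpace ℝ F] [NormedAddCommGroup F'] [NormedSpace ℝ F']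
    [TopologicalSpace H] {I : ModelWithCorners ℝ EN H} [TopologicalSpace N] [ChartedSpace H N]
    (L : F →L[ℝ] F') {φ : N → F} {x : N} (hφ : MDifferentiableAt I 𝓘(ℝ, F) φ x)
    (v : TangentSpace I x) :
    mvfderiv I (fun y ↦ L (φ y)) x v = L (mvfderiv I φ x v) := by
  have h := (L.hasFDerivAt.hasMFDerivAt.comp x hφ.hasMFDerivAt).mfderiv
  exact congrArg (fun l : EN →L[ℝ] F' ↦ l v) h

/-- The chart components of `Ξ` are its derivatives of the base coordinates, which are the
components of `Z`, and its derivatives of the fibre coordinates, which are evaluations on coordinate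
fields. -/
lemma cotDiffFieldAt_of_liftEval {Ξ : Π q : CotangentBundle E M, TangentSpace (cotModel E) q}
    {p : CotangentBundle E M} {Z : Π y : M, TangentSpace 𝓘(ℝ, E) y} (hZ : DiffFieldAt Z p.proj)
    (h1 : ∀ q, hPart q (Ξ q) = Z q.proj)
    (h2 : ∀ w : E, MDifferentiableAt (cotModel E) 𝓘(ℝ, ℝ)
      (fun q ↦ mvfderiv (cotModel E) (liftEval (coordField p.proj w)) q (Ξ q)) p) :
    CotDiffFieldAt Ξ p := by
  refine mdifferentiableAt_of_mvfderiv_extChartAt ?_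
  have hs : ∀ᶠ q in 𝓝 p, MDifferentiableAt (cotModel E) 𝓘(ℝ, E × (E →L[ℝ] ℝ))
      (extChartAt (cotModel E) p) q := by
    filter_upwards [(chartAt (ModelProd E (E →L[ℝ] ℝ)) p).open_source.mem_nhds
      (mem_chart_source _ p)] with q hq
    exact mdifferentiableAt_extChartAt hq
  have hs' : ∀ᶠ q in 𝓝 p, MDifferentiableAt 𝓘(ℝ, E) 𝓘(ℝ, E)
      (extChartAt 𝓘(ℝ, E) p.proj) q.proj := by
    have := (contMDiffAt_proj (E := E) 1 p).continuousAt
    filter_upwards [this ((chartAt E p.proj).open_source.mem_nhds (mem_chart_source _ p.proj))]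
      with q hq
    exact mdifferentiableAt_extChartAt hq
  have e1 : MDifferentiableAt (cotModel E) 𝓘(ℝ, E)
      (fun q ↦ (mvfderiv (cotModel E) (extChartAt (cotModel E) p) q (Ξ q)).1) p := by
    refine (mdifferentiableAt_comp_proj (mdifferentiableAt_mvfderiv_extChartAt hZ)
      ).congr_of_eventuallyEq ?_
    filter_upwards [hs, hs'] with q hq hq'
    have := mvfderiv_clm_comp (ContinuousLinearMap.fst ℝ E (E →L[ℝ] ℝ)) hq (Ξ q)
    refine this.symm.trans ?_
    exact (mvfderiv_comp_proj hq' (Ξ q)).trans (by rw [h1])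
  have e2 : MDifferentiableAt (cotModel E) 𝓘(ℝ, E →L[ℝ] ℝ)
      (fun q ↦ (mvfderiv (cotModel E) (extChartAt (cotModel E) p) q (Ξ q)).2) p := by
    refine mdifferentiableAt_dual fun w ↦ (h2 w).congr_of_eventuallyEq ?_
    filter_upwards [hs] with q hq
    have := mvfderiv_clm_comp ((ContinuousLinearMap.apply ℝ ℝ w).comp
      (ContinuousLinearMap.snd ℝ E (E →L[ℝ] ℝ))) hq (Ξ q)
    refine this.symm.trans ?_
    exact mvfderiv_congr (Filter.Eventually.of_forall fun q ↦ extChartAt_cotangent_snd p q w) _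
  exact e1.prodMk_space e2

section

variable {g : Metric E M} {cov : Connection E M}

lemma mvfderiv_liftEval_hField {Y Z : Π y : M, TangentSpace 𝓘(ℝ, E) y}
    {q : CotangentBundle E M} (hZ : DiffFieldAt Z q.proj) :
    mvfderiv (cotModel E) (liftEval Z) q (hField cov Y q)
      = liftEval (fun y ↦ cov Z y (Y y)) q := by
  rw [mvfderiv_liftEval cov hZ, hField, vPart_hLift, hPart_hLift]
  simp [liftEval]

lemma mvfderiv_liftEval_vField {A Z : Π y : M, TangentSpace 𝓘(ℝ, E) y}
    {q : CotangentBundle E M} (cov : Connection E M) (hZ : DiffFieldAt Z q.proj) :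
    mvfderiv (cotModel E) (liftEval Z) q (vField g A q) = g.inner q.proj (A q.proj) (Z q.proj) := by
  rw [mvfderiv_liftEval cov hZ, vField, vPart_vLift, hPart_vLift]
  simp

lemma eventually_proj {P : M → Prop} {p : CotangentBundle E M} (h : ∀ᶠ y in 𝓝 p.proj, P y) :
    ∀ᶠ q : CotangentBundle E M in 𝓝 p, P q.proj :=
  (contMDiffAt_proj (E := E) 1 p).continuousAt.eventually h

lemma cdiffFieldAt_coordField (x : M) (w : TangentSpace 𝓘(ℝ, E) x) :
    CDiffFieldAt 2 (coordField x w) x :=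
  (contMDiffAt_coordField x w (FiberBundle.mem_baseSet_trivializationAt' x)).of_le two_le_infty

/-- The horizontal lift differentiates `p(∂_w)` to `p(∇_Z ∂_w)`, so the `C^1` regularity of `∇` is
exactly what is needed. -/
lemma cotDiffFieldAt_hField (hcov : IsLeviCivita (fun x u v ↦ g.inner x u v) cov)
    {Z : Π y : M, TangentSpace 𝓘(ℝ, E) y}
    {p : CotangentBundle E M} (hZ : CDiffFieldAt 2 Z p.proj) :
    CotDiffFieldAt (hField cov Z) p := by
  refine cotDiffFieldAt_of_liftEval (hZ.diffFieldAt (by norm_num)) (fun q ↦ hPart_hLift cov q _)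
    fun w ↦ ?_
  have hw : CDiffFieldAt 2 (coordField p.proj w) p.proj := cdiffFieldAt_coordField _ _
  refine (mdifferentiableAt_liftEval
    ((cdiffFieldAt_cov g hcov hZ hw).diffFieldAt le_rfl)).congr_of_eventuallyEq ?_
  filter_upwards [eventually_proj hw.eventually] with q hq
  exact mvfderiv_liftEval_hField (hq.diffFieldAt (by norm_num))

lemma cotDiffFieldAt_vField (cov : Connection E M) {A : Π y : M, TangentSpace 𝓘(ℝ, E) y}
    {p : CotangentBundle E M} (hA : CDiffFieldAt 2 A p.proj) :
    CotDiffFieldAt (vField g A) p := by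
  refine cotDiffFieldAt_of_liftEval (Z := fun _ ↦ 0) (mdifferentiableAt_zeroSection ..)
    (fun q ↦ hPart_vLift q _) fun w ↦ ?_
  have hw : CDiffFieldAt 2 (coordField p.proj w) p.proj := cdiffFieldAt_coordField _ _
  refine (mdifferentiableAt_comp_proj (mdifferentiableAt_inner g (hA.diffFieldAt (by norm_num))
    (hw.diffFieldAt (by norm_num)))).congr_of_eventuallyEq ?_
  filter_upwards [eventually_proj hw.eventually] with q hq
  exact mvfderiv_liftEval_vField cov (hq.diffFieldAt (by norm_num))

end

end

section

variable {E : Type*} [NormedAddCommGroup E] [NormedSpace ℝ E]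
  {M : Type*} [TopologicalSpace M] [ChartedSpace E M] [IsManifold 𝓘(ℝ, E) ∞ M]
  [FiniteDimensional ℝ E] {g : Metric E M} {cov : Connection E M}

/-! ### Lie brackets of lifts -/

lemma mvfderiv_extChartAt_self (x : M) (u : TangentSpace 𝓘(ℝ, E) x) :
    mvfderiv 𝓘(ℝ, E) (extChartAt 𝓘(ℝ, E) x) x u = u :=
  mvfderiv_of_eventuallyEq_comp_extChartAt (φ' := id) (by rfl) (hasFDerivAt_id _) u

lemma mvfderiv_extChartAt_proj {p q : CotangentBundle E M}
    (hq : q.proj ∈ (chartAt E p.proj).source) (ξ : TangentSpace (cotModel E) q) :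
    mvfderiv (cotModel E) (fun q : CotangentBundle E M ↦ extChartAt 𝓘(ℝ, E) p.proj q.proj) q ξ
      = mvfderiv 𝓘(ℝ, E) (extChartAt 𝓘(ℝ, E) p.proj) q.proj (hPart q ξ) :=
  mvfderiv_comp_proj (mdifferentiableAt_extChartAt hq) ξ

/-- The Lie bracket of projectable vector fields is projectable. -/
lemma hPart_mlieBracket {Ξ Ξ' : Π q : CotangentBundle E M, TangentSpace (cotModel E) q}
    {p : CotangentBundle E M} {X Y : Π y : M, TangentSpace 𝓘(ℝ, E) y}
    (hΞ : CotDiffFieldAt Ξ p) (hΞ' : CotDiffFieldAt Ξ' p)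
    (hX : DiffFieldAt X p.proj) (hY : DiffFieldAt Y p.proj)
    (h1 : ∀ q, hPart q (Ξ q) = X q.proj) (h2 : ∀ q, hPart q (Ξ' q) = Y q.proj) :
    hPart p (mlieBracket (cotModel E) Ξ Ξ' p) = mlieBracket 𝓘(ℝ, E) X Y p.proj := by
  have hp := mem_chart_source E p.proj
  have hφ : ContMDiffAt 𝓘(ℝ, E) 𝓘(ℝ, E) 2 (extChartAt 𝓘(ℝ, E) p.proj) p.proj :=
    contMDiffAt_extChartAt
  have hφ' : ContMDiffAt (cotModel E) 𝓘(ℝ, E) 2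
      (fun q : CotangentBundle E M ↦ extChartAt 𝓘(ℝ, E) p.proj q.proj) p :=
    ContMDiffAt.comp p hφ (contMDiffAt_proj 2 p)
  -- The test function is the base chart pulled back to `T*M`; a projectable field differentiates it
  -- as its projection does, so both iterated derivatives descend to `M`.
  have key : ∀ {Ξ : Π q : CotangentBundle E M, TangentSpace (cotModel E) q}
      {X : Π y : M, TangentSpace 𝓘(ℝ, E) y} (_ : DiffFieldAt X p.proj)
      (_ : ∀ q, hPart q (Ξ q) = X q.proj) (ξ : TangentSpace (cotModel E) p),
      mvfderiv (cotModel E) (fun q ↦ mvfderiv (cotModel E)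
        (fun q : CotangentBundle E M ↦ extChartAt 𝓘(ℝ, E) p.proj q.proj) q (Ξ q)) p ξ
      = mvfderiv 𝓘(ℝ, E) (fun y ↦ mvfderiv 𝓘(ℝ, E) (extChartAt 𝓘(ℝ, E) p.proj) y (X y)) p.proj
        (hPart p ξ) := by
    intro Ξ X hX h1 ξ
    rw [← mvfderiv_comp_proj (mdifferentiableAt_mvfderiv_apply hφ hX)]
    refine mvfderiv_congr ?_ ξ
    filter_upwards [eventually_proj ((chartAt E p.proj).open_source.mem_nhds hp)] with q hq
    rw [mvfderiv_extChartAt_proj hq, h1]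
  have h := mvfderiv_mlieBracket hφ' hΞ hΞ'
  rw [mvfderiv_extChartAt_proj hp, key hY h2, key hX h1, h1, h2, ← mvfderiv_mlieBracket hφ hX hY,
    mvfderiv_extChartAt_self, mvfderiv_extChartAt_self] at h
  exact h

lemma vPart_apply_eq (cov : Connection E M) {p : CotangentBundle E M}
    (ξ : TangentSpace (cotModel E) p) {Z : Π y : M, TangentSpace 𝓘(ℝ, E) y}
    (hZ : DiffFieldAt Z p.proj) :
    vPart cov p ξ (Z p.proj)
      = mvfderiv (cotModel E) (liftEval Z) p ξ - p.2 (cov Z p.proj (hPart p ξ)) := by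
  rw [mvfderiv_liftEval cov hZ]
  ring

lemma hPart_hField (Z : Π y : M, TangentSpace 𝓘(ℝ, E) y) (q : CotangentBundle E M) :
    hPart q (hField cov Z q) = Z q.proj := rfl

lemma hPart_vField (A : Π y : M, TangentSpace 𝓘(ℝ, E) y) (q : CotangentBundle E M) :
    hPart q (vField g A q) = 0 := rfl

lemma diffFieldAt_zero (x : M) : DiffFieldAt (fun y : M ↦ (0 : TangentSpace 𝓘(ℝ, E) y)) x :=
  mdifferentiableAt_zeroSection ..

lemma mvfderiv_mvfderiv_liftEval_hField (hcov : IsLeviCivita (fun x u v ↦ g.inner x u v) cov)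
    {p : CotangentBundle E M} {Y Z : Π y : M, TangentSpace 𝓘(ℝ, E) y}
    (hY : CDiffFieldAt 2 Y p.proj) (hZ : CDiffFieldAt 2 Z p.proj)
    (ξ : TangentSpace (cotModel E) p) :
    mvfderiv (cotModel E) (fun q ↦ mvfderiv (cotModel E) (liftEval Z) q (hField cov Y q)) p ξ
      = p.2 (cov (fun y ↦ cov Z y (Y y)) p.proj (hPart p ξ))
        + vPart cov p ξ (cov Z p.proj (Y p.proj)) := by
  rw [← mvfderiv_liftEval cov (Z := fun y ↦ cov Z y (Y y))
    ((cdiffFieldAt_cov g hcov hY hZ).diffFieldAt le_rfl)]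
  refine mvfderiv_congr ?_ ξ
  filter_upwards [eventually_proj hZ.eventually] with q hq
  exact mvfderiv_liftEval_hField (hq.diffFieldAt (by norm_num))

lemma mvfderiv_mvfderiv_liftEval_vField (cov : Connection E M) {p : CotangentBundle E M}
    {A Z : Π y : M, TangentSpace 𝓘(ℝ, E) y}
    (hA : CDiffFieldAt 2 A p.proj) (hZ : CDiffFieldAt 2 Z p.proj)
    (ξ : TangentSpace (cotModel E) p) :
    mvfderiv (cotModel E) (fun q ↦ mvfderiv (cotModel E) (liftEval Z) q (vField g A q)) p ξ
      = mvfderiv 𝓘(ℝ, E) (fun y ↦ g.inner y (A y) (Z y)) p.proj (hPart p ξ) := by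
  rw [← mvfderiv_comp_proj (mdifferentiableAt_inner g (hA.diffFieldAt (by norm_num))
    (hZ.diffFieldAt (by norm_num)))]
  refine mvfderiv_congr ?_ ξ
  filter_upwards [eventually_proj hZ.eventually] with q hq
  exact mvfderiv_liftEval_vField cov (hq.diffFieldAt (by norm_num))

/-- On `p ↦ p(Z)` the iterated derivatives are `p(∇_X ∇_Y Z)` and `p(∇_Y ∇_X Z)`; taking the
vertical part subtracts `p(∇_{[X, Y]} Z)`. -/
lemma vPart_mlieBracket_hField_hField (hcov : IsLeviCivita (fun x u v ↦ g.inner x u v) cov)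
    {p : CotangentBundle E M} {X Y Z : Π y : M, TangentSpace 𝓘(ℝ, E) y}
    (hX : CDiffFieldAt 2 X p.proj) (hY : CDiffFieldAt 2 Y p.proj) (hZ : CDiffFieldAt 2 Z p.proj) :
    vPart cov p (mlieBracket (cotModel E) (hField cov X) (hField cov Y) p) (Z p.proj)
      = p.2 (riemann cov X Y Z p.proj) := by
  have hZ' := hZ.diffFieldAt (by norm_num)
  rw [vPart_apply_eq cov _ hZ', mvfderiv_mlieBracket (contMDiffAt_liftEval hZ)
    (cotDiffFieldAt_hField hcov hX) (cotDiffFieldAt_hField hcov hY),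
    hPart_mlieBracket (cotDiffFieldAt_hField hcov hX) (cotDiffFieldAt_hField hcov hY)
      (hX.diffFieldAt (by norm_num)) (hY.diffFieldAt (by norm_num))
      (hPart_hField X) (hPart_hField Y),
    mvfderiv_mvfderiv_liftEval_hField hcov hY hZ, mvfderiv_mvfderiv_liftEval_hField hcov hX hZ]
  simp only [hField, hPart_hLift, vPart_hLift, riemann, map_sub]
  simp

lemma mlieBracket_hField_hField (hcov : IsLeviCivita (fun x u v ↦ g.inner x u v) cov)
    {p : CotangentBundle E M} {X Y : Π y : M, TangentSpace 𝓘(ℝ, E) y}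
    (hX : CDiffFieldAt 2 X p.proj) (hY : CDiffFieldAt 2 Y p.proj) :
    hPart p (mlieBracket (cotModel E) (hField cov X) (hField cov Y) p)
      = mlieBracket 𝓘(ℝ, E) X Y p.proj :=
  hPart_mlieBracket (cotDiffFieldAt_hField hcov hX) (cotDiffFieldAt_hField hcov hY)
      (hX.diffFieldAt (by norm_num)) (hY.diffFieldAt (by norm_num))
      (hPart_hField X) (hPart_hField Y)

lemma eq_of_vPart_eq {p : CotangentBundle E M} (cov : Connection E M)
    {ξ ξ' : TangentSpace (cotModel E) p} (h1 : hPart p ξ = hPart p ξ')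
    (h2 : ∀ Z : Π y : M, TangentSpace 𝓘(ℝ, E) y, CDiffFieldAt 2 Z p.proj →
      vPart cov p ξ (Z p.proj) = vPart cov p ξ' (Z p.proj)) : ξ = ξ' := by
  have h3 : vPart cov p ξ = vPart cov p ξ' := by
    ext w
    have := h2 _ (cdiffFieldAt_coordField p.proj w)
    rwa [coordField_self] at this
  rw [← hLift_add_vLift cov p ξ, ← hLift_add_vLift cov p ξ', h1, h3]

/-- On `p ↦ p(Z)` the bracket gives `X(g(A, Z)) - g(A, ∇_X Z)`, which is `g(∇_X A, Z)` because `∇`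
is metric. -/
lemma mlieBracket_hField_vField (hcov : IsLeviCivita (fun x u v ↦ g.inner x u v) cov)
    {p : CotangentBundle E M} {X A : Π y : M, TangentSpace 𝓘(ℝ, E) y}
    (hX : CDiffFieldAt 2 X p.proj) (hA : CDiffFieldAt 2 A p.proj) :
    mlieBracket (cotModel E) (hField cov X) (vField g A) p
      = vLift p (g.inner p.proj (cov A p.proj (X p.proj))) := by
  have h1 : hPart p (mlieBracket (cotModel E) (hField cov X) (vField g A) p) = 0 := by
    rw [hPart_mlieBracket (cotDiffFieldAt_hField hcov hX) (cotDiffFieldAt_vField cov hA)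
      (hX.diffFieldAt (by norm_num)) (diffFieldAt_zero _) (hPart_hField X) (hPart_vField A)]
    exact congrFun mlieBracket_zero_right p.proj
  refine eq_of_vPart_eq cov (h1.trans (hPart_vLift p _).symm) fun Z hZ ↦ ?_
  have hZ' := hZ.diffFieldAt (by norm_num)
  rw [vPart_apply_eq cov _ hZ', mvfderiv_mlieBracket (contMDiffAt_liftEval hZ)
    (cotDiffFieldAt_hField hcov hX) (cotDiffFieldAt_vField cov hA), h1,
    mvfderiv_mvfderiv_liftEval_hField hcov hX hZ, mvfderiv_mvfderiv_liftEval_vField cov hA hZ,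
    vPart_vLift, hPart_hField, hPart_vField,
    hcov.metric p.proj _ A Z (hA.diffFieldAt (by norm_num)) hZ', vField, vPart_vLift]
  simp

/-- A vertical lift sends `p ↦ p(Z)` to a function constant on the fibres, and the other vertical
lift kills it. -/
lemma mlieBracket_vField_vField (cov : Connection E M)
    {p : CotangentBundle E M} {A B : Π y : M, TangentSpace 𝓘(ℝ, E) y}
    (hA : CDiffFieldAt 2 A p.proj) (hB : CDiffFieldAt 2 B p.proj) :
    mlieBracket (cotModel E) (vField g A) (vField g B) p = 0 := by
  have h1 : hPart p (mlieBracket (cotModel E) (vField g A) (vField g B) p) = 0 := by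
    rw [hPart_mlieBracket (cotDiffFieldAt_vField cov hA) (cotDiffFieldAt_vField cov hB)
      (diffFieldAt_zero _) (diffFieldAt_zero _) (hPart_vField A) (hPart_vField B)]
    exact congrFun mlieBracket_zero_right p.proj
  refine eq_of_vPart_eq cov h1 fun Z hZ ↦ ?_
  have hZ' := hZ.diffFieldAt (by norm_num)
  have h0 : vPart cov p (0 : TangentSpace (cotModel E) p) = 0 := vPart_vLift cov p 0
  rw [vPart_apply_eq cov _ hZ', mvfderiv_mlieBracket (contMDiffAt_liftEval hZ)
    (cotDiffFieldAt_vField cov hA) (cotDiffFieldAt_vField cov hB), h1,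
    mvfderiv_mvfderiv_liftEval_vField cov hA hZ, mvfderiv_mvfderiv_liftEval_vField cov hB hZ,
    hPart_vField, hPart_vField, h0]
  simp

end

section

variable {E : Type*} [NormedAddCommGroup E] [NormedSpace ℝ E]
  {M : Type*} [TopologicalSpace M] [ChartedSpace E M] [IsManifold 𝓘(ℝ, E) ∞ M]
  [FiniteDimensional ℝ E] {g : Metric E M} {cov : Connection E M}

/-! ### The function `α` and the metric on lifts -/

lemma inner_sharp (g : Metric E M) {x : M} (θ : Cotangent E x) (u : TangentSpace 𝓘(ℝ, E) x) :
    g.inner x (sharp g θ) u = θ u := by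
  have h : flat g x (sharp g θ) = θ := (flat g x).apply_symm_apply θ
  rw [flat_apply] at h
  rw [h]

lemma inner_sharp_eq (g : Metric E M) {x : M} (θ : Cotangent E x) :
    g.inner x (sharp g θ) = θ :=
  (flat g x).apply_symm_apply θ

lemma sharp_inner (g : Metric E M) {x : M} (u : TangentSpace 𝓘(ℝ, E) x) :
    sharp g (g.inner x u) = u :=
  (flat g x).symm_apply_apply u

lemma inner_sharp_right (g : Metric E M) {x : M} (θ : Cotangent E x) (u : TangentSpace 𝓘(ℝ, E) x) :
    g.inner x u (sharp g θ) = θ u := by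
  rw [g.symm, inner_sharp]

lemma coinner_eq_inner (g : Metric E M) {x : M} (η θ : Cotangent E x) :
    coinner g η θ = g.inner x (sharp g η) (sharp g θ) :=
  (inner_sharp g η _).symm

lemma coinner_comm (g : Metric E M) {x : M} (η θ : Cotangent E x) :
    coinner g η θ = coinner g θ η := by
  rw [coinner_eq_inner, coinner_eq_inner, g.symm]

lemma coinner_inner (g : Metric E M) {x : M} (u : TangentSpace 𝓘(ℝ, E) x) (θ : Cotangent E x) :
    coinner g (g.inner x u) θ = θ u := by
  rw [coinner_comm, coinner, sharp_inner]

lemma inner_self_nonneg (g : Metric E M) (x : M) (u : TangentSpace 𝓘(ℝ, E) x) :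
    0 ≤ g.inner x u u := by
  by_cases h : u = 0
  · simp [h]
  · exact (g.pos x u h).le

lemma alpha_pos (g : Metric E M) (p : CotangentBundle E M) : 0 < alpha g p := by
  have := inner_self_nonneg g p.proj (sharp g p.2)
  rw [alpha, coinner_eq_inner]
  linarith

/-- In a dual frame `α = 1 + ∑ p(∂_i) p(ε_i)` near the given point. Two derivatives are needed to
apply a bracket to `α`. -/
lemma contMDiffAt_alpha (g : Metric E M) (p : CotangentBundle E M) :
    ContMDiffAt (cotModel E) 𝓘(ℝ, ℝ) 2 (alpha g) p := by
  classical
  obtain ⟨ε, hε, h⟩ := exists_dual_frame g p.proj (Module.finBasis ℝ E)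
  have h1 : ContMDiffAt (cotModel E) 𝓘(ℝ, ℝ) 2 (fun q : CotangentBundle E M ↦ ∑ i,
      liftEval (coordField p.proj (Module.finBasis ℝ E i)) q * liftEval (ε i) q) p :=
    ContMDiffAt.sum fun i _ ↦ (contMDiffAt_liftEval (cdiffFieldAt_coordField p.proj _)).mul
      (contMDiffAt_liftEval ((hε i).of_le two_le_infty))
  refine ((contMDiffAt_const (c := (1 : ℝ))).add h1).congr_of_eventuallyEq ?_
  filter_upwards [eventually_proj h] with q hq
  have h2 := congrArg q.2 (hq (sharp g q.2))
  simp only [inner_sharp, map_sum, map_smul, smul_eq_mul] at h2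
  simp only [alpha, coinner, Pi.add_apply, liftEval]
  rw [h2]

lemma mdifferentiableAt_alpha (g : Metric E M) (p : CotangentBundle E M) :
    MDifferentiableAt (cotModel E) 𝓘(ℝ, ℝ) (alpha g) p :=
  (contMDiffAt_alpha g p).mdifferentiableAt (by norm_num)

lemma mvfderiv_eq_zero_of_isMinOn {p : CotangentBundle E M} {φ : CotangentBundle E M → ℝ}
    (hφ : MDifferentiableAt (cotModel E) 𝓘(ℝ, ℝ) φ p) (h : ∀ q, φ p ≤ φ q)
    (ξ : TangentSpace (cotModel E) p) : mvfderiv (cotModel E) φ p ξ = 0 := by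
  have h1 := mvfderiv_extChartAt_symm (I := cotModel E) (x := p) (φ := φ)
    (FiberBundle.extend (E × (E →L[ℝ] ℝ)) ξ) (mem_extChartAt_target p)
    (by rwa [extChartAt_to_inv])
  have h2 : IsLocalMin (φ ∘ (extChartAt (cotModel E) p).symm) (extChartAt (cotModel E) p p) := by
    refine Filter.Eventually.of_forall fun z ↦ ?_
    rw [Function.comp_apply, extChartAt_to_inv]
    exact h _
  rw [h2.fderiv_eq_zero, extChartAt_to_inv, FiberBundle.extend_apply_self] at h1
  exact h1

/-- The derivative of `α`. -/
lemma mvfderiv_alpha (hcov : IsLeviCivita (fun x u v ↦ g.inner x u v) cov)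
    (p : CotangentBundle E M) (ξ : TangentSpace (cotModel E) p) :
    mvfderiv (cotModel E) (alpha g) p ξ = 2 * vPart cov p ξ (sharp g p.2) := by
  set P := coordField p.proj (sharp g p.2) with hP
  have hP0 : P p.proj = sharp g p.2 := coordField_self _ _
  have hP1 : DiffFieldAt P p.proj := (cdiffFieldAt_coordField p.proj _).diffFieldAt (by norm_num)
  -- Completing the square: with `P` extending `p♯`, the function `α` exceeds `2q(P) - g(P, P)` by
  -- `1 + |q♯ - P|²`, which is minimal at `p`. Both functions therefore have the same differential
  -- at `p`, and no derivative of `g⁻¹` is computed.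
  have e : ∀ q : CotangentBundle E M, alpha g q - (2 * liftEval P q - g.inner q.proj (P q.proj) (P q.proj))
      = 1 + g.inner q.proj (sharp g q.2 - P q.proj) (sharp g q.2 - P q.proj) := by
    intro q
    have h1 := inner_sharp g q.2 (P q.proj)
    have h2 := g.symm q.proj (P q.proj) (sharp g q.2)
    simp only [alpha, coinner_eq_inner, liftEval, map_sub, sub_apply]
    rw [h2, h1]
    ring
  have m1 := mdifferentiableAt_liftEval (p := p) hP1
  have m2 := mdifferentiableAt_comp_proj (p := p) (mdifferentiableAt_inner g hP1 hP1)
  have m3 := (mdifferentiableAt_const (I := cotModel E) (c := (2 : ℝ)) (x := p)).mul m1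
  have h := mvfderiv_eq_zero_of_isMinOn ((mdifferentiableAt_alpha g p).sub (m3.sub m2)) (fun q ↦ by
    simp only [Pi.sub_apply, Pi.mul_apply]
    rw [e p, e q, hP0, sub_self]
    simpa only [map_zero, add_zero, le_add_iff_nonneg_right] using
      inner_self_nonneg g q.proj (sharp g q.2 - P q.proj)) ξ
  rw [mvfderiv_sub (mdifferentiableAt_alpha g p) (m3.sub m2), mvfderiv_sub m3 m2,
    mvfderiv_mul mdifferentiableAt_const m1, mvfderiv_const] at h
  simp only [sub_apply, add_apply, smul_apply, zero_apply, smul_eq_mul] at h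
  -- The derivatives of `P` cancel, since `g(∇P, p♯) = p(∇P)`.
  rw [mvfderiv_liftEval cov hP1, mvfderiv_comp_proj (mdifferentiableAt_inner g hP1 hP1),
    hcov.metric p.proj _ P P hP1 hP1, hP0, g.symm p.proj (cov P p.proj (hPart p ξ)),
    inner_sharp] at h
  linarith

/-- The inner product of two vertical lifts. -/
lemma cgMetric_vField_vField (g : Metric E M) (cov : Connection E M) (f : M → ℝ)
    (A B : Π y : M, TangentSpace 𝓘(ℝ, E) y) (q : CotangentBundle E M) :
    cgMetric g cov f q (vField g A q) (vField g B q)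
      = (alpha g q)⁻¹ * (g.inner q.proj (A q.proj) (B q.proj) + liftEval A q * liftEval B q) := by
  rw [vField, vField, cgMetric_vLift_vLift, coinner_inner, coinner_inner, coinner_inner,
    g.symm, one_div]
  rfl

lemma cgMetric_hField_hField (g : Metric E M) (cov : Connection E M) (f : M → ℝ)
    (Y Z : Π y : M, TangentSpace 𝓘(ℝ, E) y) (q : CotangentBundle E M) :
    cgMetric g cov f q (hField cov Y q) (hField cov Z q)
      = f q.proj * g.inner q.proj (Y q.proj) (Z q.proj) :=
  cgMetric_hLift_hLift g cov f q _ _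

lemma cgMetric_symm (g : Metric E M) (cov : Connection E M) (f : M → ℝ)
    (q : CotangentBundle E M) (ξ ζ : TangentSpace (cotModel E) q) :
    cgMetric g cov f q ξ ζ = cgMetric g cov f q ζ ξ := by
  unfold cgMetric
  rw [g.symm, coinner_comm g (vPart cov q ξ) (vPart cov q ζ),
    mul_comm (coinner g (vPart cov q ξ) q.2)]

lemma hPart_sub (q : CotangentBundle E M) (ξ ζ : TangentSpace (cotModel E) q) :
    hPart q (ξ - ζ) = hPart q ξ - hPart q ζ := rfl

lemma hPart_add (q : CotangentBundle E M) (ξ ζ : TangentSpace (cotModel E) q) :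
    hPart q (ξ + ζ) = hPart q ξ + hPart q ζ := rfl

lemma hPart_smul (q : CotangentBundle E M) (c : ℝ) (ξ : TangentSpace (cotModel E) q) :
    hPart q (c • ξ) = c • hPart q ξ := rfl

lemma vPart_apply (cov : Connection E M) (q : CotangentBundle E M)
    (ξ : TangentSpace (cotModel E) q) (w : TangentSpace 𝓘(ℝ, E) q.proj) :
    vPart cov q ξ w = mvfderiv (cotModel E) (liftEval (coordField q.proj w)) q ξ
      - q.2 (cov (coordField q.proj w) q.proj (hPart q ξ)) := by
  rw [← vPart_apply_eq cov ξ ((cdiffFieldAt_coordField q.proj w).diffFieldAt (by norm_num)),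
    coordField_self]

lemma vPart_add (cov : Connection E M) (q : CotangentBundle E M)
    (ξ ζ : TangentSpace (cotModel E) q) :
    vPart cov q (ξ + ζ) = vPart cov q ξ + vPart cov q ζ := by
  ext w
  rw [add_apply, vPart_apply, vPart_apply, vPart_apply, hPart_add,
    (mvfderiv (cotModel E) (liftEval (coordField q.proj w)) q).map_add,
    (cov (coordField q.proj w) q.proj).map_add, q.2.map_add]
  ring

lemma vPart_sub (cov : Connection E M) (q : CotangentBundle E M)
    (ξ ζ : TangentSpace (cotModel E) q) :
    vPart cov q (ξ - ζ) = vPart cov q ξ - vPart cov q ζ := by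
  ext w
  rw [sub_apply, vPart_apply, vPart_apply, vPart_apply, hPart_sub,
    (mvfderiv (cotModel E) (liftEval (coordField q.proj w)) q).map_sub,
    (cov (coordField q.proj w) q.proj).map_sub, q.2.map_sub]
  ring

lemma vPart_smul (cov : Connection E M) (q : CotangentBundle E M) (c : ℝ)
    (ξ : TangentSpace (cotModel E) q) :
    vPart cov q (c • ξ) = c • vPart cov q ξ := by
  ext w
  rw [smul_apply, vPart_apply, vPart_apply, hPart_smul,
    (mvfderiv (cotModel E) (liftEval (coordField q.proj w)) q).map_smul,
    (cov (coordField q.proj w) q.proj).map_smul, q.2.map_smul, smul_eq_mul, smul_eq_mul,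
    smul_eq_mul]
  ring

lemma hPart_zero (q : CotangentBundle E M) :
    hPart q (0 : TangentSpace (cotModel E) q) = 0 := rfl

lemma vPart_zero (cov : Connection E M) (q : CotangentBundle E M) :
    vPart cov q (0 : TangentSpace (cotModel E) q) = 0 :=
  vPart_vLift cov q 0

lemma hPart_neg (q : CotangentBundle E M) (ξ : TangentSpace (cotModel E) q) :
    hPart q (-ξ) = -hPart q ξ := rfl

lemma vPart_neg (cov : Connection E M) (q : CotangentBundle E M)
    (ξ : TangentSpace (cotModel E) q) : vPart cov q (-ξ) = -vPart cov q ξ := by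
  rw [← zero_sub, vPart_sub, vPart_zero, zero_sub]

lemma coinner_sub_left (g : Metric E M) {x : M} (η θ ζ : Cotangent E x) :
    coinner g (η - θ) ζ = coinner g η ζ - coinner g θ ζ := rfl

lemma cgMetric_sub_left (g : Metric E M) (cov : Connection E M) (f : M → ℝ)
    (q : CotangentBundle E M) (ξ ζ χ : TangentSpace (cotModel E) q) :
    cgMetric g cov f q (ξ - ζ) χ = cgMetric g cov f q ξ χ - cgMetric g cov f q ζ χ := by
  simp only [cgMetric, vPart_sub, hPart_sub, coinner_sub_left, map_sub, sub_apply]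
  ring

lemma cgMetric_hLift_right (g : Metric E M) (cov : Connection E M) (f : M → ℝ)
    (q : CotangentBundle E M) (ξ : TangentSpace (cotModel E) q) (u : TangentSpace 𝓘(ℝ, E) q.proj) :
    cgMetric g cov f q ξ (hLift cov q u) = f q.proj * g.inner q.proj (hPart q ξ) u := by
  simp [cgMetric, coinner_zero_left, coinner_zero_right]

lemma cgMetric_vLift_right (g : Metric E M) (cov : Connection E M) (f : M → ℝ)
    (q : CotangentBundle E M) (ξ : TangentSpace (cotModel E) q) (u : TangentSpace 𝓘(ℝ, E) q.proj) :
    cgMetric g cov f q ξ (vLift q (g.inner q.proj u))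
      = (alpha g q)⁻¹ * (vPart cov q ξ u + vPart cov q ξ (sharp g q.2) * q.2 u) := by
  simp only [cgMetric, vPart_vLift, hPart_vLift, coinner_inner]
  simp [coinner, sharp_inner]

/-- A tangent vector of `T*M` is determined by its inner products with lifts. -/
lemma eq_of_cgMetric_eq (g : Metric E M) (cov : Connection E M) {f : M → ℝ} (hf : ∀ x, 0 < f x)
    {q : CotangentBundle E M} {ξ ζ : TangentSpace (cotModel E) q}
    (h1 : ∀ u : TangentSpace 𝓘(ℝ, E) q.proj,
      cgMetric g cov f q ξ (hLift cov q u) = cgMetric g cov f q ζ (hLift cov q u))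
    (h2 : ∀ u : TangentSpace 𝓘(ℝ, E) q.proj,
      cgMetric g cov f q ξ (vLift q (g.inner q.proj u))
        = cgMetric g cov f q ζ (vLift q (g.inner q.proj u))) : ξ = ζ := by
  have hh : hPart q ξ = hPart q ζ := by
    by_contra hne
    have h3 := h1 (hPart q ξ - hPart q ζ)
    rw [cgMetric_hLift_right, cgMetric_hLift_right, mul_right_inj' (hf _).ne', ← sub_eq_zero,
      ← sub_apply, ← map_sub] at h3
    exact (g.pos q.proj _ (sub_ne_zero.2 hne)).ne' h3
  have hv : vPart cov q ξ = vPart cov q ζ := by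
    set δ := vPart cov q ξ - vPart cov q ζ with hδ
    have h3 := h2 (sharp g δ)
    rw [cgMetric_vLift_right, cgMetric_vLift_right,
      mul_right_inj' (inv_ne_zero (alpha_pos g q).ne')] at h3
    -- Testing with `u = δ♯` gives `|δ|² + δ(p♯)² = 0`, a sum of two nonnegative terms.
    have h4 : δ (sharp g δ) + δ (sharp g q.2) * q.2 (sharp g δ) = 0 := by
      simp only [hδ, sub_apply] at h3 ⊢
      linarith
    have h5 : q.2 (sharp g δ) = δ (sharp g q.2) := coinner_comm g q.2 δ
    have h6 : g.inner q.proj (sharp g δ) (sharp g δ) = 0 := by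
      have := inner_self_nonneg g q.proj (sharp g δ)
      rw [h5, ← inner_sharp g δ (sharp g δ)] at h4
      nlinarith [mul_self_nonneg (δ (sharp g q.2))]
    have h7 : sharp g δ = 0 := by
      by_contra hne
      exact (g.pos q.proj _ hne).ne' h6
    have h8 := inner_sharp_eq g δ
    rw [h7, map_zero] at h8
    exact sub_eq_zero.1 h8.symm
  rw [← hLift_add_vLift cov q ξ, ← hLift_add_vLift cov q ζ, hh, hv]

end

section

variable {E : Type*} [NormedAddCommGroup E] [NormedSpace ℝ E]
  {M : Type*} [TopologicalSpace M] [ChartedSpace E M] [IsManifold 𝓘(ℝ, E) ∞ M]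
  [FiniteDimensional ℝ E] {g : Metric E M} {cov : Connection E M}

/-! ### The curvature as the vertical part of a Lie bracket -/

lemma hLift_add (cov : Connection E M) (q : CotangentBundle E M)
    (u v : TangentSpace 𝓘(ℝ, E) q.proj) :
    hLift cov q (u + v) = hLift cov q u + hLift cov q v := by
  rw [← hLift_add_vLift cov q (hLift cov q u + hLift cov q v), vPart_add, vPart_hLift, vPart_hLift,
    hPart_add, hPart_hLift, hPart_hLift, add_zero]
  exact (add_zero _).symm

lemma hLift_smul (cov : Connection E M) (q : CotangentBundle E M) (c : ℝ)
    (u : TangentSpace 𝓘(ℝ, E) q.proj) : hLift cov q (c • u) = c • hLift cov q u := by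
  rw [← hLift_add_vLift cov q (c • hLift cov q u), vPart_smul, vPart_hLift,
    hPart_smul, hPart_hLift, smul_zero]
  exact (add_zero _).symm

lemma hField_add (cov : Connection E M) (X Y : Π y : M, TangentSpace 𝓘(ℝ, E) y) :
    hField cov (X + Y) = hField cov X + hField cov Y :=
  funext fun q ↦ hLift_add cov q _ _

lemma hField_smul (cov : Connection E M) (φ : M → ℝ) (X : Π y : M, TangentSpace 𝓘(ℝ, E) y) :
    hField cov (φ • X) = fun q ↦ φ q.proj • hField cov X q :=
  funext fun q ↦ hLift_smul cov q _ _

/-- Tensoriality quantifies over fields that are only differentiable, while `∇` is controlled on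
`C^2` fields. Expanding `Z` in a smooth frame leaves the low regularity to coefficients pulled back
from `M`. -/
lemma cotDiffFieldAt_hField_of_diffFieldAt (hcov : IsLeviCivita (fun x u v ↦ g.inner x u v) cov)
    {Z : Π y : M, TangentSpace 𝓘(ℝ, E) y} {p : CotangentBundle E M} (hZ : DiffFieldAt Z p.proj) :
    CotDiffFieldAt (hField cov Z) p := by
  classical
  obtain ⟨ε, hε, h⟩ := exists_dual_frame g p.proj (Module.finBasis ℝ E)
  have h1 : CotDiffFieldAt (fun q ↦ ∑ i, g.inner q.proj (Z q.proj)
      (coordField p.proj (Module.finBasis ℝ E i) q.proj) • hField cov (ε i) q) p :=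
    MDifferentiableAt.sum_section fun i _ ↦ MDifferentiableAt.smul_section
      (mdifferentiableAt_comp_proj (mdifferentiableAt_inner g hZ (mdifferentiableAt_coordField _ _)))
      (cotDiffFieldAt_hField hcov ((hε i).of_le two_le_infty))
  refine h1.congr_of_eventuallyEq ?_
  filter_upwards [eventually_proj h] with q hq
  refine congrArg (fun u ↦ (⟨q, u⟩ : TangentBundle (cotModel E) (CotangentBundle E M))) ?_
  refine (congrArg (hLift cov q) (hq (Z q.proj))).trans ?_
  refine (map_sum (AddMonoidHom.mk' (hLift cov q) (hLift_add cov q)) _ _).trans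
    (Finset.sum_congr rfl fun i _ ↦ ?_)
  exact hLift_smul cov q _ _

lemma vPart_hField (X : Π y : M, TangentSpace 𝓘(ℝ, E) y) (q : CotangentBundle E M) :
    vPart cov q (hField cov X q) = 0 :=
  vPart_hLift cov q _

/-- The Leibniz term of the bracket is a multiple of a horizontal lift, so it has no vertical part.
-/
lemma tensorialAt_vPart_mlieBracket_left (hcov : IsLeviCivita (fun x u v ↦ g.inner x u v) cov)
    (p : CotangentBundle E M) (Y : Π y : M, TangentSpace 𝓘(ℝ, E) y) :
    TensorialAt 𝓘(ℝ, E) E (fun X : Π y : M, TangentSpace 𝓘(ℝ, E) y ↦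
      vPart cov p (mlieBracket (cotModel E) (hField cov X) (hField cov Y) p)) p.proj where
  smul {φ X} hφ hX := by
    rw [hField_smul]
    refine (congrArg (vPart cov p) (mlieBracket_smul_left (mdifferentiableAt_comp_proj hφ)
      (cotDiffFieldAt_hField_of_diffFieldAt hcov hX))).trans ?_
    rw [vPart_add, vPart_smul, vPart_smul,
      vPart_hField, smul_zero, zero_add]
  add {X X'} hX hX' := by
    rw [hField_add, mlieBracket_add_left (cotDiffFieldAt_hField_of_diffFieldAt hcov hX)
      (cotDiffFieldAt_hField_of_diffFieldAt hcov hX'), vPart_add]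

lemma tensorialAt_vPart_mlieBracket_right (hcov : IsLeviCivita (fun x u v ↦ g.inner x u v) cov)
    (p : CotangentBundle E M) (X : Π y : M, TangentSpace 𝓘(ℝ, E) y) :
    TensorialAt 𝓘(ℝ, E) E (fun Y : Π y : M, TangentSpace 𝓘(ℝ, E) y ↦
      vPart cov p (mlieBracket (cotModel E) (hField cov X) (hField cov Y) p)) p.proj where
  smul {φ Y} hφ hY := by
    rw [hField_smul]
    refine (congrArg (vPart cov p) (mlieBracket_smul_right (mdifferentiableAt_comp_proj hφ)
      (cotDiffFieldAt_hField_of_diffFieldAt hcov hY))).trans ?_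
    rw [vPart_add, vPart_smul, vPart_smul,
      vPart_hField, smul_zero, zero_add]
  add {Y Y'} hY hY' := by
    rw [hField_add, mlieBracket_add_right (cotDiffFieldAt_hField_of_diffFieldAt hcov hY)
      (cotDiffFieldAt_hField_of_diffFieldAt hcov hY'), vPart_add]

/-- The vertical part of `[HX, HY]` is `p ∘ R(X, Y)`. -/
lemma vPart_mlieBracket_hField (hcov : IsLeviCivita (fun x u v ↦ g.inner x u v) cov)
    {p : CotangentBundle E M} {X Y : Π y : M, TangentSpace 𝓘(ℝ, E) y}
    (hX : DiffFieldAt X p.proj) (hY : DiffFieldAt Y p.proj) (w : TangentSpace 𝓘(ℝ, E) p.proj) :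
    vPart cov p (mlieBracket (cotModel E) (hField cov X) (hField cov Y) p) w
      = p.2 (curvature cov p.proj (X p.proj) (Y p.proj) w) := by
  have : FiniteDimensional ℝ (TangentSpace 𝓘(ℝ, E) p.proj) := inferInstanceAs (FiniteDimensional ℝ E)
  -- `curvature` is prescribed only on a coordinate frame. Tensoriality makes the bracket side
  -- trilinear as well, so agreement on basis vectors, one slot at a time, is enough.
  set T := TensorialAt.mkHom₂ _ p.proj
    (fun Y _ ↦ tensorialAt_vPart_mlieBracket_left hcov p Y)
    (fun X _ ↦ tensorialAt_vPart_mlieBracket_right hcov p X) with hT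
  have h1 : ∀ {X Y : Π y : M, TangentSpace 𝓘(ℝ, E) y} (_ : DiffFieldAt X p.proj)
      (_ : DiffFieldAt Y p.proj), T (X p.proj) (Y p.proj)
        = vPart cov p (mlieBracket (cotModel E) (hField cov X) (hField cov Y) p) :=
    fun hX hY ↦ TensorialAt.mkHom₂_apply _ _ hX hY
  rw [← h1 hX hY]
  generalize X p.proj = u
  generalize Y p.proj = v
  let b : Module.Basis (Fin (Module.finrank ℝ E)) ℝ (TangentSpace 𝓘(ℝ, E) p.proj) :=
    Module.finBasis ℝ E
  have hb : ∀ i j l, T (b i) (b j) (b l) = p.2 (curvature cov p.proj (b i) (b j) (b l)) := by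
    intro i j l
    have e1 : curvature cov p.proj (b i) (b j) (b l) = riemann cov (coordField p.proj (b i))
        (coordField p.proj (b j)) (coordField p.proj (b l)) p.proj := by
      unfold curvature
      erw [b.constr_basis, b.constr_basis, b.constr_basis]
    rw [e1, ← vPart_mlieBracket_hField_hField hcov (cdiffFieldAt_coordField p.proj (b i))
      (cdiffFieldAt_coordField p.proj (b j)) (cdiffFieldAt_coordField p.proj (b l)),
      coordField_self, ← h1 (mdifferentiableAt_coordField p.proj (b i))
      (mdifferentiableAt_coordField p.proj (b j)), coordField_self, coordField_self]
  have h2 : ∀ i j w, T (b i) (b j) w = p.2 (curvature cov p.proj (b i) (b j) w) := fun i j w ↦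
    LinearMap.congr_fun (b.ext (f₁ := (T (b i) (b j)).toLinearMap)
      (f₂ := p.2.toLinearMap ∘ₗ curvature cov p.proj (b i) (b j)) (hb i j)) w
  have h3 : ∀ i v w, T (b i) v w = p.2 (curvature cov p.proj (b i) v w) := fun i v w ↦
    LinearMap.congr_fun (b.ext
      (f₁ := LinearMap.applyₗ w ∘ₗ ContinuousLinearMap.coeLM ℝ ∘ₗ (T (b i)).toLinearMap)
      (f₂ := p.2.toLinearMap ∘ₗ (curvature cov p.proj (b i)).flip w) fun j ↦ h2 i j w) v
  exact LinearMap.congr_fun (b.ext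
      (f₁ := LinearMap.applyₗ w ∘ₗ ContinuousLinearMap.coeLM ℝ ∘ₗ LinearMap.applyₗ v ∘ₗ
        ContinuousLinearMap.coeLM ℝ ∘ₗ T.toLinearMap)
      (f₂ := p.2.toLinearMap ∘ₗ ((curvature cov p.proj).flip v).flip w) fun i ↦ h3 i v w) u

/-- The curvature is skew-symmetric with respect to the metric. -/
lemma vPart_mlieBracket_sharp (hcov : IsLeviCivita (fun x u v ↦ g.inner x u v) cov)
    {p : CotangentBundle E M} {X Y : Π y : M, TangentSpace 𝓘(ℝ, E) y}
    (hX : DiffFieldAt X p.proj) (hY : DiffFieldAt Y p.proj) :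
    vPart cov p (mlieBracket (cotModel E) (hField cov X) (hField cov Y) p) (sharp g p.2) = 0 := by
  -- Horizontal lifts annihilate `α`, hence so does their bracket, and the derivative of `α` along
  -- it is twice its vertical part at `p♯`.
  have h := mvfderiv_mlieBracket (contMDiffAt_alpha g p)
    (cotDiffFieldAt_hField_of_diffFieldAt hcov hX) (cotDiffFieldAt_hField_of_diffFieldAt hcov hY)
  have h0 : ∀ (X : Π y : M, TangentSpace 𝓘(ℝ, E) y) (ξ : TangentSpace (cotModel E) p),
      mvfderiv (cotModel E)
        (fun q ↦ mvfderiv (cotModel E) (alpha g) q (hField cov X q)) p ξ = 0 := by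
    intro X ξ
    have : (fun q ↦ mvfderiv (cotModel E) (alpha g) q (hField cov X q)) = fun _ ↦ 0 := by
      funext q
      rw [mvfderiv_alpha hcov, vPart_hField, zero_apply, mul_zero]
    rw [this, mvfderiv_const, zero_apply]
  rw [mvfderiv_alpha hcov, h0, h0] at h
  linarith

end

section

variable {E : Type*} [NormedAddCommGroup E] [NormedSpace ℝ E]
  {M : Type*} [TopologicalSpace M] [ChartedSpace E M] [IsManifold 𝓘(ℝ, E) ∞ M]
  [FiniteDimensional ℝ E] {g : Metric E M} {cov : Connection E M}

/-! ### Derivatives of the metric on lifts -/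

lemma mvfderiv_cgMetric_hField_hField (hcov : IsLeviCivita (fun x u v ↦ g.inner x u v) cov)
    {f : M → ℝ} {p : CotangentBundle E M} (hf : MDifferentiableAt 𝓘(ℝ, E) 𝓘(ℝ, ℝ) f p.proj)
    {Y Z : Π y : M, TangentSpace 𝓘(ℝ, E) y} (hY : DiffFieldAt Y p.proj) (hZ : DiffFieldAt Z p.proj)
    (ξ : TangentSpace (cotModel E) p) :
    mvfderiv (cotModel E) (fun q ↦ cgMetric g cov f q (hField cov Y q) (hField cov Z q)) p ξ
      = mvfderiv 𝓘(ℝ, E) f p.proj (hPart p ξ) * g.inner p.proj (Y p.proj) (Z p.proj)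
        + f p.proj * (g.inner p.proj (cov Y p.proj (hPart p ξ)) (Z p.proj)
          + g.inner p.proj (Y p.proj) (cov Z p.proj (hPart p ξ))) := by
  simp only [cgMetric_hField_hField]
  have h := mdifferentiableAt_inner g hY hZ
  rw [mvfderiv_comp_proj (φ := fun y ↦ f y * g.inner y (Y y) (Z y)) (hf.mul h),
    mvfderiv_fun_mul hf h, ← hcov.metric p.proj _ Y Z hY hZ]
  simp only [add_apply, smul_apply, smul_eq_mul]
  ring

/-- The metric times `α` is `g(A, B) + p(A)p(B)`, whose derivative is known. The product rule then
isolates the derivative of the metric, and the last term accounts for `α`. -/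
lemma mvfderiv_cgMetric_vField_vField (hcov : IsLeviCivita (fun x u v ↦ g.inner x u v) cov)
    (f : M → ℝ) {p : CotangentBundle E M}
    {A B : Π y : M, TangentSpace 𝓘(ℝ, E) y} (hA : DiffFieldAt A p.proj) (hB : DiffFieldAt B p.proj)
    (ξ : TangentSpace (cotModel E) p) :
    alpha g p * mvfderiv (cotModel E)
        (fun q ↦ cgMetric g cov f q (vField g A q) (vField g B q)) p ξ
      = g.inner p.proj (cov A p.proj (hPart p ξ)) (B p.proj)
        + g.inner p.proj (A p.proj) (cov B p.proj (hPart p ξ))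
        + (p.2 (cov A p.proj (hPart p ξ)) + vPart cov p ξ (A p.proj)) * p.2 (B p.proj)
        + p.2 (A p.proj) * (p.2 (cov B p.proj (hPart p ξ)) + vPart cov p ξ (B p.proj))
        - 2 * vPart cov p ξ (sharp g p.2) * cgMetric g cov f p (vField g A p) (vField g B p) := by
  have h1 := mdifferentiableAt_liftEval (p := p) hA
  have h2 := mdifferentiableAt_liftEval (p := p) hB
  have h3 := mdifferentiableAt_inner g hA hB
  have h4 := mdifferentiableAt_comp_proj (p := p) h3
  have h12 : MDifferentiableAt (cotModel E) 𝓘(ℝ, ℝ)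
      (fun q : CotangentBundle E M ↦ liftEval A q * liftEval B q) p := h1.mul h2
  have h5 : MDifferentiableAt (cotModel E) 𝓘(ℝ, ℝ) (fun q : CotangentBundle E M ↦
      g.inner q.proj (A q.proj) (B q.proj) + liftEval A q * liftEval B q) p := h4.add h12
  have h6 : MDifferentiableAt (cotModel E) 𝓘(ℝ, ℝ)
      (fun q ↦ cgMetric g cov f q (vField g A q) (vField g B q)) p := by
    simp only [cgMetric_vField_vField]
    have h7 : MDifferentiableAt (cotModel E) 𝓘(ℝ, ℝ) (fun q ↦ (alpha g q)⁻¹) p :=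
      (((contMDiffAt_alpha g p).inv₀ (alpha_pos g p).ne')).mdifferentiableAt (by norm_num)
    exact h7.mul h5
  have h8 : (fun q ↦ alpha g q * cgMetric g cov f q (vField g A q) (vField g B q))
      = fun q ↦ g.inner q.proj (A q.proj) (B q.proj) + liftEval A q * liftEval B q := by
    funext q
    rw [cgMetric_vField_vField, mul_inv_cancel_left₀ (alpha_pos g q).ne']
  have h9 := congrArg (fun φ : CotangentBundle E M → ℝ ↦ mvfderiv (cotModel E) φ p ξ) h8
  beta_reduce at h9
  rw [mvfderiv_fun_mul (mdifferentiableAt_alpha g p) h6, mvfderiv_fun_add h4 h12,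
    mvfderiv_fun_mul h1 h2] at h9
  simp only [add_apply, smul_apply, smul_eq_mul] at h9
  rw [mvfderiv_comp_proj h3, hcov.metric p.proj _ A B hA hB, mvfderiv_liftEval cov hA,
    mvfderiv_liftEval cov hB, mvfderiv_alpha hcov] at h9
  simp only [liftEval] at h9
  linarith

lemma mvfderiv_cgMetric_vField_hField (g : Metric E M) (cov : Connection E M) (f : M → ℝ)
    {p : CotangentBundle E M} (A Y : Π y : M, TangentSpace 𝓘(ℝ, E) y)
    (ξ : TangentSpace (cotModel E) p) :
    mvfderiv (cotModel E) (fun q ↦ cgMetric g cov f q (vField g A q) (hField cov Y q)) p ξ = 0 := by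
  have : (fun q ↦ cgMetric g cov f q (vField g A q) (hField cov Y q)) = fun _ ↦ 0 :=
    funext fun q ↦ cgMetric_vLift_hLift g cov f q _ _
  rw [this, mvfderiv_const, zero_apply]

lemma mvfderiv_cgMetric_hField_vField (g : Metric E M) (cov : Connection E M) (f : M → ℝ)
    {p : CotangentBundle E M} (A Y : Π y : M, TangentSpace 𝓘(ℝ, E) y)
    (ξ : TangentSpace (cotModel E) p) :
    mvfderiv (cotModel E) (fun q ↦ cgMetric g cov f q (hField cov Y q) (vField g A q)) p ξ = 0 := by
  rw [show (fun q ↦ cgMetric g cov f q (hField cov Y q) (vField g A q))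
    = fun q ↦ cgMetric g cov f q (vField g A q) (hField cov Y q) from
    funext fun q ↦ cgMetric_symm g cov f q _ _]
  exact mvfderiv_cgMetric_vField_hField g cov f A Y ξ

/-! ### Curvature and covariant derivatives of one-forms -/

lemma vPart_mlieBracket_hField_eq (hcov : IsLeviCivita (fun x u v ↦ g.inner x u v) cov)
    {p : CotangentBundle E M} {X Y : Π y : M, TangentSpace 𝓘(ℝ, E) y}
    (hX : DiffFieldAt X p.proj) (hY : DiffFieldAt Y p.proj) :
    vPart cov p (mlieBracket (cotModel E) (hField cov X) (hField cov Y) p)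
      = pCurvature cov p (X p.proj) (Y p.proj) := by
  ext w
  exact vPart_mlieBracket_hField hcov hX hY w

lemma pCurvature_sharp (hcov : IsLeviCivita (fun x u v ↦ g.inner x u v) cov)
    (p : CotangentBundle E M) (u v : TangentSpace 𝓘(ℝ, E) p.proj) :
    pCurvature cov p u v (sharp g p.2) = 0 := by
  have hu := mdifferentiableAt_coordField p.proj u
  have hv := mdifferentiableAt_coordField p.proj v
  have h := vPart_mlieBracket_sharp hcov hu hv
  rwa [vPart_mlieBracket_hField_eq hcov hu hv, coordField_self, coordField_self] at h

/-- Inherited from the antisymmetry of the bracket of horizontal lifts. -/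
lemma pCurvature_swap (hcov : IsLeviCivita (fun x u v ↦ g.inner x u v) cov)
    (p : CotangentBundle E M) (u v w : TangentSpace 𝓘(ℝ, E) p.proj) :
    pCurvature cov p u v w = - pCurvature cov p v u w := by
  have hu := mdifferentiableAt_coordField p.proj u
  have hv := mdifferentiableAt_coordField p.proj v
  have h := vPart_mlieBracket_hField_eq hcov hu hv
  have h' := vPart_mlieBracket_hField_eq hcov hv hu
  rw [coordField_self, coordField_self] at h h'
  rw [← h, ← h', mlieBracket_swap_apply, ← neg_one_smul ℝ, vPart_smul]
  simp

lemma inner_pSharpCurvature (g : Metric E M) (cov : Connection E M) (p : CotangentBundle E M)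
    (u v w : TangentSpace 𝓘(ℝ, E) p.proj) :
    g.inner p.proj (pSharpCurvature g cov p v w) u = pCurvature cov p u v w :=
  inner_sharp g _ u

lemma covOneForm_apply (cov : Connection E M) (θ : SmoothOneForm E M) (x : M)
    (v : TangentSpace 𝓘(ℝ, E) x) {W : Π y : M, TangentSpace 𝓘(ℝ, E) y} (hW : DiffFieldAt W x) :
    covOneForm cov θ x v (W x) = mvfderiv 𝓘(ℝ, E) (fun y ↦ θ y (W y)) x v - θ x (cov W x v) :=
  TensorialAt.mkHom_apply (tensorialAt_covOneForm cov θ x v) hW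

lemma cdiffFieldAt_sharp (g : Metric E M) (θ : SmoothOneForm E M) (x : M) :
    CDiffFieldAt 2 (fun y ↦ sharp g (θ y)) x := by
  refine cdiffFieldAt_of_inner g two_le_infty (Module.finBasis ℝ E) fun i ↦ ?_
  simp only [inner_sharp]
  have h := ContMDiffAt.clm_bundle_apply (F₂ := ℝ) (E₂ := Bundle.Trivial M ℝ)
      (b := fun y : M ↦ y) (ϕ := fun y ↦ θ y) ((θ.contMDiff x).of_le two_le_infty)
      (cdiffFieldAt_coordField x (Module.finBasis ℝ E i))
  exact (contMDiffAt_totalSpace.1 h).2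

/-- The covariant derivative of one-forms is compatible with the musical isomorphisms. -/
lemma covOneForm_eq (hcov : IsLeviCivita (fun x u v ↦ g.inner x u v) cov)
    (θ : SmoothOneForm E M) (x : M) (v : TangentSpace 𝓘(ℝ, E) x) :
    covOneForm cov θ x v = g.inner x (cov (fun y ↦ sharp g (θ y)) x v) := by
  ext w
  have hw := mdifferentiableAt_coordField x w
  have h := covOneForm_apply cov θ x v hw
  have h' := hcov.metric x v _ _ ((cdiffFieldAt_sharp g θ x).diffFieldAt (by norm_num)) hw
  simp only [inner_sharp] at h'
  rw [coordField_self] at h h'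
  rw [h, h']
  ring

lemma vLift_eq_vField (g : Metric E M) (θ : SmoothOneForm E M) :
    (fun q : CotangentBundle E M ↦ vLift q (θ q.proj)) = vField g fun y ↦ sharp g (θ y) := by
  funext q
  rw [vField, inner_sharp_eq]

end

section

variable {E : Type*} [NormedAddCommGroup E] [NormedSpace ℝ E]
  {M : Type*} [TopologicalSpace M] [ChartedSpace E M] [IsManifold 𝓘(ℝ, E) ∞ M]
  [FiniteDimensional ℝ E] {g : Metric E M} {cov : Connection E M} {f : M → ℝ}
  {covT : CotConnection E M}

/-! ### The Levi-Civita connection of the cotangent bundle -/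

lemma cgMetric_hField_right (g : Metric E M) (cov : Connection E M) (f : M → ℝ)
    (q : CotangentBundle E M) (ξ : TangentSpace (cotModel E) q)
    (Z : Π y : M, TangentSpace 𝓘(ℝ, E) y) :
    cgMetric g cov f q ξ (hField cov Z q) = f q.proj * g.inner q.proj (hPart q ξ) (Z q.proj) :=
  cgMetric_hLift_right g cov f q ξ _

lemma cgMetric_vField_right (g : Metric E M) (cov : Connection E M) (f : M → ℝ)
    (q : CotangentBundle E M) (ξ : TangentSpace (cotModel E) q)
    (A : Π y : M, TangentSpace 𝓘(ℝ, E) y) :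
    cgMetric g cov f q ξ (vField g A q)
      = (alpha g q)⁻¹ * (vPart cov q ξ (A q.proj)
        + vPart cov q ξ (sharp g q.2) * q.2 (A q.proj)) :=
  cgMetric_vLift_right g cov f q ξ _

lemma vPart_vField (cov : Connection E M) (A : Π y : M, TangentSpace 𝓘(ℝ, E) y)
    (q : CotangentBundle E M) : vPart cov q (vField g A q) = g.inner q.proj (A q.proj) :=
  vPart_vLift cov q _

lemma cotKoszul (hcovT : IsLeviCivita (cgMetric g cov f) covT) {p : CotangentBundle E M}
    {Ξ Υ Ζ : Π q : CotangentBundle E M, TangentSpace (cotModel E) q}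
    (hΞ : CotDiffFieldAt Ξ p) (hΥ : CotDiffFieldAt Υ p) (hΖ : CotDiffFieldAt Ζ p) :
    2 * cgMetric g cov f p (covT Υ p (Ξ p)) (Ζ p) =
      mvfderiv (cotModel E) (fun q ↦ cgMetric g cov f q (Υ q) (Ζ q)) p (Ξ p)
        + mvfderiv (cotModel E) (fun q ↦ cgMetric g cov f q (Ξ q) (Ζ q)) p (Υ p)
        - mvfderiv (cotModel E) (fun q ↦ cgMetric g cov f q (Ξ q) (Υ q)) p (Ζ p)
        + cgMetric g cov f p (mlieBracket (cotModel E) Ξ Υ p) (Ζ p)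
        - cgMetric g cov f p (mlieBracket (cotModel E) Ξ Ζ p) (Υ p)
        - cgMetric g cov f p (mlieBracket (cotModel E) Υ Ζ p) (Ξ p) :=
  hcovT.koszul (cgMetric_symm g cov f) (cgMetric_sub_left g cov f) hΞ hΥ hΖ

/-- Two tangent vectors of `T*M` agree if their inner products with lifts of fields agree. -/
lemma eq_of_cgMetric_field_eq (g : Metric E M) (cov : Connection E M) {f : M → ℝ}
    (hf : ∀ x, 0 < f x) {p : CotangentBundle E M} {ξ ζ : TangentSpace (cotModel E) p}
    (h1 : ∀ Z : Π y : M, TangentSpace 𝓘(ℝ, E) y, CDiffFieldAt 2 Z p.proj →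
      2 * cgMetric g cov f p ξ (hField cov Z p) = 2 * cgMetric g cov f p ζ (hField cov Z p))
    (h2 : ∀ Z : Π y : M, TangentSpace 𝓘(ℝ, E) y, CDiffFieldAt 2 Z p.proj →
      2 * cgMetric g cov f p ξ (vField g Z p) = 2 * cgMetric g cov f p ζ (vField g Z p)) :
    ξ = ζ := by
  refine eq_of_cgMetric_eq g cov hf (fun u ↦ ?_) (fun u ↦ ?_)
  · have := h1 _ (cdiffFieldAt_coordField p.proj u)
    rw [hField, coordField_self] at this
    linarith
  · have := h2 _ (cdiffFieldAt_coordField p.proj u)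
    rw [vField, coordField_self] at this
    linarith

/-- Against `HZ` only `-⟨[HY, HZ], VA⟩` survives in the Koszul formula, and it equals `p(R(Z,
Y)A)/α` because `p(R(Y, Z)p♯) = 0`. -/
lemma covT_vField_hField (hcov : IsLeviCivita (fun x u v ↦ g.inner x u v) cov)
    (hf : ∀ x, MDifferentiableAt 𝓘(ℝ, E) 𝓘(ℝ, ℝ) f x) (hf_pos : ∀ x, 0 < f x)
    (hcovT : IsLeviCivita (cgMetric g cov f) covT) {p : CotangentBundle E M}
    {A Y : Π y : M, TangentSpace 𝓘(ℝ, E) y} (hA : CDiffFieldAt 2 A p.proj)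
    (hY : CDiffFieldAt 2 Y p.proj) :
    covT (hField cov Y) p (vField g A p) = (1 / (2 * f p.proj * alpha g p)) •
      hLift cov p (pSharpCurvature g cov p (Y p.proj) (A p.proj)) := by
  have hA' := hA.diffFieldAt (by norm_num)
  have hY' := hY.diffFieldAt (by norm_num)
  have hVA := cotDiffFieldAt_vField (g := g) cov hA
  have hHY := cotDiffFieldAt_hField hcov hY
  have hα := (alpha_pos g p).ne'
  have hfp := (hf_pos p.proj).ne'
  have hVY : mlieBracket (cotModel E) (vField g A) (hField cov Y) p
      = -vLift p (g.inner p.proj (cov A p.proj (Y p.proj))) := by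
    rw [mlieBracket_swap_apply, mlieBracket_hField_vField hcov hY hA]
  refine eq_of_cgMetric_field_eq g cov hf_pos (fun Z hZ ↦ ?_) (fun B hB ↦ ?_)
  · have hZ' := hZ.diffFieldAt (by norm_num)
    have hVZ : mlieBracket (cotModel E) (vField g A) (hField cov Z) p
        = -vLift p (g.inner p.proj (cov A p.proj (Z p.proj))) := by
      rw [mlieBracket_swap_apply, mlieBracket_hField_vField hcov hZ hA]
    rw [cotKoszul hcovT hVA hHY (cotDiffFieldAt_hField hcov hZ),
      mvfderiv_cgMetric_hField_hField hcov (hf _) hY' hZ', mvfderiv_cgMetric_vField_hField,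
      mvfderiv_cgMetric_vField_hField, hVY, hVZ]
    simp only [cgMetric_hField_right, cgMetric_vField_right, hPart_vField, hPart_neg, hPart_vLift,
      hPart_smul, hPart_hLift, map_zero, zero_apply, neg_zero, map_smul, smul_apply,
      smul_eq_mul, mul_zero, zero_mul, add_zero, sub_zero, zero_sub, inner_pSharpCurvature,
      vPart_mlieBracket_hField_eq hcov hY' hZ', pCurvature_sharp hcov,
      pCurvature_swap hcov p (Z p.proj) (Y p.proj)]
    field_simp
  · have hB' := hB.diffFieldAt (by norm_num)
    rw [cotKoszul hcovT hVA hHY (cotDiffFieldAt_vField cov hB),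
      mvfderiv_cgMetric_hField_vField, mvfderiv_cgMetric_vField_hField, hVY,
      mlieBracket_vField_vField cov hA hB, mlieBracket_hField_vField hcov hY hB]
    -- The vertical component vanishes: the derivative of `⟨VA, VB⟩` along `HY` cancels against the
    -- brackets of `HY` with `VA` and `VB`.
    have h := mvfderiv_cgMetric_vField_vField hcov f hA' hB' (hField cov Y p)
    rw [hPart_hField, vPart_hField] at h
    simp only [zero_apply] at h
    have h' := eq_div_of_mul_eq (c := alpha g p) hα ((mul_comm _ _).trans h)
    rw [h']
    simp only [cgMetric_hField_right, cgMetric_vField_right, vPart_neg, vPart_vLift, hPart_zero,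
      vPart_smul, vPart_hLift, map_zero, zero_apply, neg_apply, smul_apply, inner_sharp_right,
      smul_eq_mul, mul_zero, zero_mul, add_zero, sub_zero]
    rw [g.symm p.proj (A p.proj)]
    field_simp
    ring

end

/-! ### The remaining covariant derivatives of lifts. -/

section

variable {E : Type*} [NormedAddCommGroup E] [NormedSpace ℝ E]
  {M : Type*} [TopologicalSpace M] [ChartedSpace E M] [IsManifold 𝓘(ℝ, E) ∞ M]
  [FiniteDimensional ℝ E] {g : Metric E M} {cov : Connection E M} {f : M → ℝ}
  {covT : CotConnection E M}

/-- Torsion-freeness: the two mixed derivatives differ by the bracket `[HX, VB]`. -/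
lemma covT_hField_vField (hcov : IsLeviCivita (fun x u v ↦ g.inner x u v) cov)
    (hf : ∀ x, MDifferentiableAt 𝓘(ℝ, E) 𝓘(ℝ, ℝ) f x) (hf_pos : ∀ x, 0 < f x)
    (hcovT : IsLeviCivita (cgMetric g cov f) covT) {p : CotangentBundle E M}
    {X B : Π y : M, TangentSpace 𝓘(ℝ, E) y} (hX : CDiffFieldAt 2 X p.proj)
    (hB : CDiffFieldAt 2 B p.proj) :
    covT (vField g B) p (hField cov X p) = (1 / (2 * f p.proj * alpha g p)) •
      hLift cov p (pSharpCurvature g cov p (X p.proj) (B p.proj))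
        + vLift p (g.inner p.proj (cov B p.proj (X p.proj))) := by
  rw [← covT_vField_hField hcov hf hf_pos hcovT hB hX, ← mlieBracket_hField_vField hcov hX hB,
    ← hcovT.torsion_free p _ _ (cotDiffFieldAt_hField hcov hX) (cotDiffFieldAt_vField cov hB)]
  exact (add_sub_cancel _ _).symm

/-- On horizontal lifts the metric is `f g`, so the horizontal component is that of the conformal
metric: the Koszul terms of `g` give `∇_X Y`, and the derivatives of `f` give `tensorA`. Against a
vertical lift only `⟨[HX, HY], VA⟩` remains, whence half the curvature. -/
lemma covT_hField_hField (hcov : IsLeviCivita (fun x u v ↦ g.inner x u v) cov)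
    (hf : ∀ x, MDifferentiableAt 𝓘(ℝ, E) 𝓘(ℝ, ℝ) f x) (hf_pos : ∀ x, 0 < f x)
    (hcovT : IsLeviCivita (cgMetric g cov f) covT) {p : CotangentBundle E M}
    {X Y : Π y : M, TangentSpace 𝓘(ℝ, E) y} (hX : CDiffFieldAt 2 X p.proj)
    (hY : CDiffFieldAt 2 Y p.proj) :
    covT (hField cov Y) p (hField cov X p)
      = hLift cov p (cov Y p.proj (X p.proj) + tensorA g f p.proj (X p.proj) (Y p.proj))
        + (1 / 2 : ℝ) • vLift p (pCurvature cov p (X p.proj) (Y p.proj)) := by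
  have hX' := hX.diffFieldAt (by norm_num)
  have hY' := hY.diffFieldAt (by norm_num)
  have hHX := cotDiffFieldAt_hField hcov hX
  have hHY := cotDiffFieldAt_hField hcov hY
  have hfp := (hf_pos p.proj).ne'
  refine eq_of_cgMetric_field_eq g cov hf_pos (fun Z hZ ↦ ?_) (fun A hA ↦ ?_)
  · have hZ' := hZ.diffFieldAt (by norm_num)
    rw [cotKoszul hcovT hHX hHY (cotDiffFieldAt_hField hcov hZ),
      mvfderiv_cgMetric_hField_hField hcov (hf _) hY' hZ',
      mvfderiv_cgMetric_hField_hField hcov (hf _) hX' hZ',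
      mvfderiv_cgMetric_hField_hField hcov (hf _) hX' hY']
    simp only [cgMetric_hField_right, mlieBracket_hField_hField hcov hX hY,
      mlieBracket_hField_hField hcov hX hZ, mlieBracket_hField_hField hcov hY hZ,
      ← hcov.torsion_free p.proj X Y hX' hY', ← hcov.torsion_free p.proj X Z hX' hZ',
      ← hcov.torsion_free p.proj Y Z hY' hZ', hPart_hField, hPart_add, hPart_smul, hPart_hLift,
      hPart_vLift, smul_zero, add_zero, tensorA, map_add, map_sub, map_smul, add_apply, sub_apply,
      smul_apply, smul_eq_mul, inner_sharp, g.symm p.proj (Y p.proj) (cov Z p.proj (X p.proj)),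
      g.symm p.proj (X p.proj) (cov Z p.proj (Y p.proj)),
      g.symm p.proj (X p.proj) (cov Y p.proj (Z p.proj))]
    field_simp
    ring
  · have hA' := hA.diffFieldAt (by norm_num)
    rw [cotKoszul hcovT hHX hHY (cotDiffFieldAt_vField cov hA),
      mvfderiv_cgMetric_hField_vField, mvfderiv_cgMetric_hField_vField,
      mvfderiv_cgMetric_hField_hField hcov (hf _) hX' hY',
      mlieBracket_hField_vField hcov hX hA, mlieBracket_hField_vField hcov hY hA]
    simp only [cgMetric_hField_right, cgMetric_vField_right, hPart_vField, hPart_vLift, vPart_add,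
      vPart_smul, vPart_hLift, vPart_vLift, map_zero, zero_apply, smul_apply,
      smul_eq_mul, mul_zero, zero_mul, add_zero, sub_zero, zero_add,
      vPart_mlieBracket_hField_eq hcov hX' hY']
    ring

/-- Since `g⁻¹(p, p) = α - 1`, the two summands add up to `α p(A)` and the factor `1/α` disappears.
-/
lemma cgMetric_vField_liouville (g : Metric E M) (cov : Connection E M) (f : M → ℝ)
    (A : Π y : M, TangentSpace 𝓘(ℝ, E) y) (p : CotangentBundle E M) :
    cgMetric g cov f p (vField g A p) (liouville p) = p.2 (A p.proj) := by
  have hα := (alpha_pos g p).ne'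
  rw [vField, liouville, cgMetric_vLift_vLift, coinner_inner,
    show coinner g p.2 p.2 = alpha g p - 1 by rw [alpha]; ring]
  field_simp
  ring

/-- Vertical brackets vanish, so the vertical component is a combination of three fibre derivatives
of the metric. The horizontal component is zero because `HZ` differentiates `⟨VA, VB⟩` exactly as
its brackets with `VA` and `VB` prescribe. -/
lemma covT_vField_vField (hcov : IsLeviCivita (fun x u v ↦ g.inner x u v) cov)
    (hf_pos : ∀ x, 0 < f x) (hcovT : IsLeviCivita (cgMetric g cov f) covT)
    {p : CotangentBundle E M} {A B : Π y : M, TangentSpace 𝓘(ℝ, E) y}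
    (hA : CDiffFieldAt 2 A p.proj) (hB : CDiffFieldAt 2 B p.proj) :
    covT (vField g B) p (vField g A p)
      = -(1 / alpha g p) •
          (cgMetric g cov f p (vField g A p) (liouville p) • vField g B p
            + cgMetric g cov f p (vField g B p) (liouville p) • vField g A p)
        + ((alpha g p + 1) / alpha g p
            * cgMetric g cov f p (vField g A p) (vField g B p)) • liouville p
        - (1 / alpha g p * cgMetric g cov f p (vField g A p) (liouville p)
            * cgMetric g cov f p (vField g B p) (liouville p)) • liouville p := by
  have hA' := hA.diffFieldAt (by norm_num)
  have hB' := hB.diffFieldAt (by norm_num)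
  have hVA := cotDiffFieldAt_vField (g := g) cov hA
  have hVB := cotDiffFieldAt_vField (g := g) cov hB
  have hα := (alpha_pos g p).ne'
  have hl : hPart p (liouville p) = 0 := hPart_vLift p _
  have hl' : vPart cov p (liouville p) = p.2 := vPart_vLift cov p _
  have hp : p.2 (sharp g p.2) = alpha g p - 1 := by
    rw [alpha, coinner]
    ring
  -- Along a vertical lift `g(A, B)` is constant; only `p(A)`, `p(B)` and `α` vary.
  have key : ∀ {A B : Π y : M, TangentSpace 𝓘(ℝ, E) y} (C : Π y : M, TangentSpace 𝓘(ℝ, E) y)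
      (_ : DiffFieldAt A p.proj) (_ : DiffFieldAt B p.proj),
      mvfderiv (cotModel E) (fun q ↦ cgMetric g cov f q (vField g A q) (vField g B q)) p
        (vField g C p) = (g.inner p.proj (C p.proj) (A p.proj) * p.2 (B p.proj)
          + p.2 (A p.proj) * g.inner p.proj (C p.proj) (B p.proj)
          - 2 * p.2 (C p.proj) * cgMetric g cov f p (vField g A p) (vField g B p)) / alpha g p := by
    intro A B C hA hB
    have h := mvfderiv_cgMetric_vField_vField hcov f hA hB (vField g C p)
    rw [hPart_vField, vPart_vField] at h
    simp only [map_zero, zero_apply, add_zero, zero_add, inner_sharp_right] at h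
    exact eq_div_of_mul_eq hα ((mul_comm _ _).trans h)
  rw [cgMetric_vField_liouville, cgMetric_vField_liouville]
  refine eq_of_cgMetric_field_eq g cov hf_pos (fun Z hZ ↦ ?_) (fun C hC ↦ ?_)
  · have hZ' := hZ.diffFieldAt (by norm_num)
    have hZA : mlieBracket (cotModel E) (vField g A) (hField cov Z) p
        = -vLift p (g.inner p.proj (cov A p.proj (Z p.proj))) := by
      rw [mlieBracket_swap_apply, mlieBracket_hField_vField hcov hZ hA]
    have hZB : mlieBracket (cotModel E) (vField g B) (hField cov Z) p
        = -vLift p (g.inner p.proj (cov B p.proj (Z p.proj))) := by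
      rw [mlieBracket_swap_apply, mlieBracket_hField_vField hcov hZ hB]
    have h := mvfderiv_cgMetric_vField_vField hcov f hA' hB' (hField cov Z p)
    rw [hPart_hField, vPart_hField] at h
    simp only [zero_apply] at h
    rw [cotKoszul hcovT hVA hVB (cotDiffFieldAt_hField hcov hZ),
      mvfderiv_cgMetric_vField_hField, mvfderiv_cgMetric_vField_hField,
      eq_div_of_mul_eq hα ((mul_comm _ _).trans h), hZA, hZB, mlieBracket_vField_vField cov hA hB]
    simp only [cgMetric_hField_right, cgMetric_vField_right, hPart_vField, hPart_add, hPart_sub,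
      hPart_smul, hPart_zero, hl, vPart_neg, vPart_vLift, map_zero, zero_apply, neg_apply,
      inner_sharp_right, smul_zero, mul_zero, zero_mul, add_zero, sub_zero]
    rw [g.symm p.proj (A p.proj)]
    field_simp
    ring
  · have hC' := hC.diffFieldAt (by norm_num)
    rw [cotKoszul hcovT hVA hVB (cotDiffFieldAt_vField cov hC), key A hB' hC', key B hA' hC',
      key C hA' hB', mlieBracket_vField_vField cov hA hB, mlieBracket_vField_vField cov hA hC,
      mlieBracket_vField_vField cov hB hC]
    simp only [cgMetric_vField_right, vPart_vField, vPart_add, vPart_sub, vPart_smul, vPart_zero,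
      hl', zero_apply, add_apply, sub_apply, smul_apply, smul_eq_mul, inner_sharp_right, hp,
      zero_mul, mul_zero, add_zero, sub_zero, g.symm p.proj (B p.proj) (A p.proj),
      g.symm p.proj (C p.proj)]
    field_simp
    ring

end

end CotangentGeometry

end

theorem mainTheorem12 {E : Type*} [NormedAddCommGroup E] [NormedSpace ℝ E] [FiniteDimensional ℝ E]
    {M : Type*} [TopologicalSpace M] [T2Space M] [ChartedSpace E M] [IsManifold 𝓘(ℝ, E) ∞ M]
    (g : Metric E M) (cov : Connection E M)
    (hcov : IsLeviCivita (fun x u v ↦ g.inner x u v) cov)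
    (f : M → ℝ) (hf : ContMDiff 𝓘(ℝ, E) 𝓘(ℝ, ℝ) ∞ f) (hf_pos : ∀ x, 0 < f x)
    (covT : CotConnection E M) (hcovT : IsLeviCivita (cgMetric g cov f) covT)
    (X Y : SmoothVectorField E M) (η θ : SmoothOneForm E M) (p : CotangentBundle E M) :
    (covT (fun q ↦ hLift cov q (Y q.proj)) p (hLift cov p (X p.proj))
      = hLift cov p (cov Y p.proj (X p.proj) + tensorA g f p.proj (X p.proj) (Y p.proj))
        + (1 / 2 : ℝ) • vLift p (pCurvature cov p (X p.proj) (Y p.proj)))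
    ∧ (covT (fun q ↦ vLift q (θ q.proj)) p (hLift cov p (X p.proj))
      = (1 / (2 * f p.proj * alpha g p)) •
          hLift cov p (pSharpCurvature g cov p (X p.proj) (sharp g (θ p.proj)))
        + vLift p (covOneForm cov θ p.proj (X p.proj)))
    ∧ (covT (fun q ↦ hLift cov q (Y q.proj)) p (vLift p (η p.proj))
      = (1 / (2 * f p.proj * alpha g p)) •
          hLift cov p (pSharpCurvature g cov p (Y p.proj) (sharp g (η p.proj))))
    ∧ (covT (fun q ↦ vLift q (θ q.proj)) p (vLift p (η p.proj))
      = -(1 / alpha g p) •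
          (cgMetric g cov f p (vLift p (η p.proj)) (liouville p) • vLift p (θ p.proj)
            + cgMetric g cov f p (vLift p (θ p.proj)) (liouville p) • vLift p (η p.proj))
        + ((alpha g p + 1) / alpha g p
            * cgMetric g cov f p (vLift p (η p.proj)) (vLift p (θ p.proj))) • liouville p
        - (1 / alpha g p * cgMetric g cov f p (vLift p (η p.proj)) (liouville p)
            * cgMetric g cov f p (vLift p (θ p.proj)) (liouville p)) • liouville p) := by
  have hf' : ∀ x, MDifferentiableAt 𝓘(ℝ, E) 𝓘(ℝ, ℝ) f x :=
    fun x ↦ (hf x).mdifferentiableAt (by simp)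
  have hX : CDiffFieldAt 2 X p.proj := (X.contMDiff p.proj).of_le two_le_infty
  have hY : CDiffFieldAt 2 Y p.proj := (Y.contMDiff p.proj).of_le two_le_infty
  have hη := cdiffFieldAt_sharp g η p.proj
  have hθ := cdiffFieldAt_sharp g θ p.proj
  have hη' : vLift p (η p.proj) = vField g (fun y ↦ sharp g (η y)) p :=
    congrFun (vLift_eq_vField g η) p
  have hθ' : vLift p (θ p.proj) = vField g (fun y ↦ sharp g (θ y)) p :=
    congrFun (vLift_eq_vField g θ) p
  -- One-forms are replaced by the fields `sharp g θ` and `sharp g η`, and `∇_X θ` by the dual of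
  -- `∇_X θ♯`.
  rw [vLift_eq_vField g θ, hη', hθ', covOneForm_eq hcov]
  exact ⟨covT_hField_hField hcov hf' hf_pos hcovT hX hY,
    covT_hField_vField hcov hf' hf_pos hcovT hX hθ,
    covT_vField_hField hcov hf' hf_pos hcovT hη hY,
    covT_vField_vField hcov hf_pos hcovT hη hθ⟩
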